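/- Let $d\ge 1$. A state of dimension $d$ is a positive semidefinite matrix $\sigma\in\mathbb C^{d\times d}$ with $\operatorname{tr}\sigma=1$. The uniform POVM is $\{d\,|u\rangle\langle u|\,\mathrm du\}$, where $\mathrm du$ is the law of a Haar random vector $|u\rangle=U|1\rangle$, with $U$ distributed according to the Haar probability measure on the unitary group $\mathrm U(d)$; measuring $\sigma$ with it returns $u$ with law $d\,\langle u|\sigma|u\rangle\,\mathrm du$. Given $n\ge k$ copies of $\sigma$, measure each copy separately (so only unentangled measurements are used) with the uniform POVM, obtaining independent outcomes $u_1,\dots,u_n$; put $\widehat\sigma_i=(d+1)|u_i\rangle\langle u_i|-I$ and $$Z_k=\frac{1}{n(n-1)\cdots(n-k+1)}\sum_{\substack{i_1,\dots,i_k\in\{1,\dots,n\}\\ \text{distinct}}}\operatorname{tr}\bigl(\widehat\sigma_{i_1}\widehat\sigma_{i_2}\cdots\widehat\sigma_{i_k}\bigr)\in\mathbb R .$$ Let $S_k(\sigma)=\frac{1}{1-k}\log\operatorname{tr}(\sigma^k)$ be the quantum Rényi entropy of order $k$. **Theorem.** For every integer $k\ge 2$ there is a constant $C=C(k)>0$ such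 that for every $d\ge1$, every state $\sigma$ of dimension $d$, every $\delta>0$ and every integer $n\ge k$ with $$n\ \ge\ C\cdot\max\left\{\frac{d^{2-2/k}}{\delta^2},\ \frac{d^{3-2/k}}{\delta^{2/k}}\right\}$$ the following hold. 1. With probability at least $0.99$, $(1-\delta)\operatorname{tr}(\sigma^k)\le Z_k\le(1+\delta)\operatorname{tr}(\sigma^k)$. 2. If moreover $\delta<1/2$, then with probability at least $0.99$ both the bounds in 1 and $\left|\frac{1}{1-k}\log Z_k-S_k(\sigma)\right|\le\delta$ hold simultaneously. -/

import Mathlib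

open MeasureTheory
open scoped ComplexOrder

noncomputable section

/-- A density matrix (quantum state): a positive semidefinite matrix of unit trace. -/
structure IsDensityMatrix {d : ℕ} (σ : Matrix (Fin d) (Fin d) ℂ) : Prop where
  posSemidef : σ.PosSemidef
  trace_eq_one : σ.trace = 1

/-- The rank-one matrix `|u⟩⟨u|`. -/
def ketbra {d : ℕ} (u : Fin d → ℂ) : Matrix (Fin d) (Fin d) ℂ :=
  Matrix.vecMulVec u (star u)

/-! ### Haar measure on the unitary group and Haar random vectors -/

instance instMeasurableSpaceUnitary (d : ℕ) :
    MeasurableSpace (Matrix.unitaryGroup (Fin d) ℂ) := borel _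

instance instBorelSpaceUnitary (d : ℕ) : BorelSpace (Matrix.unitaryGroup (Fin d) ℂ) := ⟨rfl⟩

instance instCompactSpaceUnitary (d : ℕ) : CompactSpace (Matrix.unitaryGroup (Fin d) ℂ) := by
  have hc : IsCompact {A : Fin d → Fin d → ℂ | ∀ i j, A i j ∈ Metric.closedBall (0 : ℂ) 1} := by
    have := isCompact_univ_pi (X := fun _ : Fin d => Fin d → ℂ)
      (s := fun _ => Set.univ.pi fun _ : Fin d => Metric.closedBall (0 : ℂ) 1)
      (fun _ => isCompact_univ_pi fun _ => isCompact_closedBall 0 1)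
    convert this using 1
    ext A
    simp [Set.mem_pi]
  change IsCompact {A : Matrix (Fin d) (Fin d) ℂ | ∀ i j, A i j ∈ Metric.closedBall (0 : ℂ) 1} at hc
  refine isCompact_iff_compactSpace.mp (hc.of_isClosed_subset isClosed_unitary ?_)
  intro U hU i j
  simpa using entry_norm_bound_of_unitary hU i j

/-- The Haar probability measure on the unitary group `U(d)`. -/
def haarUnitary (d : ℕ) : Measure (Matrix.unitaryGroup (Fin d) ℂ) :=
  Measure.haarMeasure ⊤

instance instIsProbabilityMeasureHaarUnitary (d : ℕ) : IsProbabilityMeasure (haarUnitary d) :=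
  ⟨by simpa [haarUnitary] using Measure.haarMeasure_self (K₀ := (⊤ : TopologicalSpace.PositiveCompacts
    (Matrix.unitaryGroup (Fin d) ℂ)))⟩

instance instIsMulLeftInvariantHaarUnitary (d : ℕ) : (haarUnitary d).IsMulLeftInvariant := by
  unfold haarUnitary; infer_instance

/-- The first column `U|1⟩` of a unitary matrix. -/
def firstColumn {d : ℕ} [NeZero d] (U : Matrix.unitaryGroup (Fin d) ℂ) : Fin d → ℂ :=
  fun i => U.1 i 0

/-- The law of a Haar random vector in `ℂ^d`, i.e. of `U|1⟩` for a Haar random unitary `U`. -/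
def haarVector (d : ℕ) [NeZero d] : Measure (Fin d → ℂ) :=
  (haarUnitary d).map firstColumn

theorem continuous_firstColumn {d : ℕ} [NeZero d] : Continuous (firstColumn (d := d)) :=
  continuous_pi fun i => (continuous_subtype_val.matrix_elem i 0)

instance instIsProbabilityMeasureHaarVector (d : ℕ) [NeZero d] :
    IsProbabilityMeasure (haarVector d) :=
  Measure.isProbabilityMeasure_map continuous_firstColumn.measurable.aemeasurable

/-! ### Measurements -/

/-- A POVM with outcomes in `Ω` on a `d`-dimensional system, `{density ω · ref(dω)}`:
positive semidefinite matrices indexed by the outcomes that integrate to the identity. -/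
structure POVM (Ω : Type*) [MeasurableSpace Ω] (d : ℕ) where
  /-- the reference measure on the outcomes -/
  ref : Measure Ω
  /-- the operator density of the measurement -/
  density : Ω → Matrix (Fin d) (Fin d) ℂ
  posSemidef : ∀ ω, (density ω).PosSemidef
  integrable : ∀ i j, Integrable (fun ω => density ω i j) ref
  integral_eq : ∀ i j, ∫ ω, density ω i j ∂ref = (1 : Matrix (Fin d) (Fin d) ℂ) i j

/-- The Born rule: measuring the state `σ` with the POVM gives an outcome distributed as
`tr(density ω · σ) · ref(dω)`. -/
def POVM.outcome {Ω : Type*} [MeasurableSpace Ω] {d : ℕ} (M : POVM Ω d)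
    (σ : Matrix (Fin d) (Fin d) ℂ) : Measure Ω :=
  M.ref.withDensity fun ω => ENNReal.ofReal ((M.density ω * σ).trace).re

open scoped MatrixOrder in
theorem POVM.isProbabilityMeasure_outcome {Ω : Type*} [MeasurableSpace Ω] {d : ℕ}
    (M : POVM Ω d) {σ : Matrix (Fin d) (Fin d) ℂ} (hσ : IsDensityMatrix σ) :
    IsProbabilityMeasure (M.outcome σ) := by
  have hnn : ∀ ω, 0 ≤ ((M.density ω * σ).trace).re := by
    intro ω
    obtain ⟨B, hB⟩ := CStarAlgebra.nonneg_iff_eq_star_mul_self.mp hσ.posSemidef.nonneg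
    rw [hB, Matrix.star_eq_conjTranspose, ← Matrix.mul_assoc, Matrix.trace_mul_comm, ← Matrix.mul_assoc]
    exact (Complex.nonneg_iff.mp
      ((M.posSemidef ω).mul_mul_conjTranspose_same B).trace_nonneg).1
  have hint : ∀ i ∈ Finset.univ, Integrable (fun ω => ∑ j, M.density ω i j * σ j i) M.ref :=
    fun i _ => integrable_finsetSum _ fun j _ => (M.integrable i j).mul_const _
  have htr : Integrable (fun ω => (M.density ω * σ).trace) M.ref := by
    simpa only [Matrix.trace, Matrix.diag, Matrix.mul_apply] using integrable_finsetSum _ hint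
  have hval : ∫ ω, (M.density ω * σ).trace ∂M.ref = 1 := by
    simp only [Matrix.trace, Matrix.diag, Matrix.mul_apply]
    rw [integral_finsetSum _ hint, ← hσ.trace_eq_one, Matrix.trace]
    refine Finset.sum_congr rfl fun i _ => ?_
    rw [integral_finsetSum _ fun j _ => (M.integrable i j).mul_const _]
    simp_rw [integral_mul_const, M.integral_eq]
    rw [← Matrix.mul_apply, Matrix.one_mul, Matrix.diag]
  refine ⟨?_⟩
  rw [POVM.outcome, withDensity_apply _ MeasurableSet.univ, Measure.restrict_univ,
    ← ofReal_integral_eq_lintegral_ofReal (f := fun ω => ((M.density ω * σ).trace).re) htr.re (Filter.Eventually.of_forall hnn)]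
  have := integral_re htr
  simp only [RCLike.re_to_complex] at this
  rw [this, hval]
  simp

/-- The joint law of the outcomes when each of `n` copies of `σ` is measured separately
(an unentangled measurement) with the same POVM: the outcomes are independent, each with
the law given by the Born rule. -/
def POVM.outcomeCopies {Ω : Type*} [MeasurableSpace Ω] {d : ℕ} (M : POVM Ω d)
    (σ : Matrix (Fin d) (Fin d) ℂ) (n : ℕ) : Measure (Fin n → Ω) :=
  Measure.pi fun _ => M.outcome σ

theorem integrable_unitary_entries {d : ℕ} [NeZero d] (i j : Fin d) :
    Integrable (fun U => firstColumn U i * star (firstColumn U j)) (haarUnitary d) := by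
  have hc : Continuous fun U : Matrix.unitaryGroup (Fin d) ℂ =>
      firstColumn U i * star (firstColumn U j) :=
    ((continuous_apply i).comp continuous_firstColumn).mul
      ((continuous_apply j).comp continuous_firstColumn).star
  exact hc.integrable_of_hasCompactSupport (HasCompactSupport.of_compactSpace _)

/-- `𝔼 |u⟩⟨u| = I / d` for a Haar random vector `u`. -/
theorem integral_unitary_entries {d : ℕ} [NeZero d] (i j : Fin d) :
    ∫ U, firstColumn U i * star (firstColumn U j) ∂(haarUnitary d)
      = (d : ℂ)⁻¹ * (1 : Matrix (Fin d) (Fin d) ℂ) i j := by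
  have inv : ∀ (V : Matrix.unitaryGroup (Fin d) ℂ) (i j : Fin d),
      ∫ U, firstColumn (V * U) i * star (firstColumn (V * U) j) ∂(haarUnitary d)
        = ∫ U, firstColumn U i * star (firstColumn U j) ∂(haarUnitary d) := fun V i j =>
    integral_mul_left_eq_self
      (fun U => firstColumn U i * star (firstColumn U j)) V
  have off : ∀ i j : Fin d, i ≠ j →
      ∫ U, firstColumn U i * star (firstColumn U j) ∂(haarUnitary d) = 0 := by
    intro i j hij
    let D : Matrix (Fin d) (Fin d) ℂ := Matrix.diagonal fun l => if l = i then -1 else 1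
    have hD : D ∈ Matrix.unitaryGroup (Fin d) ℂ := by
      rw [Matrix.mem_unitaryGroup_iff, Matrix.star_eq_conjTranspose,
        Matrix.diagonal_conjTranspose, Matrix.diagonal_mul_diagonal, ← Matrix.diagonal_one]
      congr 1
      ext l
      by_cases h : l = i <;> simp [h]
    have key : ∀ (U : Matrix.unitaryGroup (Fin d) ℂ) (l : Fin d),
        firstColumn ((⟨D, hD⟩ : Matrix.unitaryGroup (Fin d) ℂ) * U) l
          = (if l = i then -1 else 1) * firstColumn U l := by
      intro U l
      change (D * U.1) l 0 = _
      rw [Matrix.diagonal_mul]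
      rfl
    have h := inv ⟨D, hD⟩ i j
    simp only [key, if_true, if_neg hij.symm, one_mul, neg_mul, integral_neg] at h
    have h2 := neg_eq_self.mp h
    exact h2
  have diag : ∀ i j : Fin d,
      ∫ U, firstColumn U i * star (firstColumn U i) ∂(haarUnitary d)
        = ∫ U, firstColumn U j * star (firstColumn U j) ∂(haarUnitary d) := by
    intro i j
    let P : Matrix (Fin d) (Fin d) ℂ := (Equiv.swap i j).permMatrix ℂ
    have hP : P ∈ Matrix.unitaryGroup (Fin d) ℂ := by
      rw [Matrix.mem_unitaryGroup_iff, Matrix.star_eq_conjTranspose,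
        Matrix.conjTranspose_permMatrix, ← Matrix.permMatrix_mul]
      simp
    have key : ∀ (U : Matrix.unitaryGroup (Fin d) ℂ),
        firstColumn ((⟨P, hP⟩ : Matrix.unitaryGroup (Fin d) ℂ) * U) i = firstColumn U j := by
      intro U
      change (P * U.1) i 0 = U.1 j 0
      simp [P, Equiv.Perm.permMatrix, PEquiv.toMatrix_toPEquiv_mul]
    have h := inv ⟨P, hP⟩ i i
    simp only [key] at h
    exact h.symm
  by_cases hij : i = j
  · subst hij
    have hsum : ∑ l : Fin d, ∫ U, firstColumn U l * star (firstColumn U l) ∂(haarUnitary d)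
        = 1 := by
      rw [← integral_finsetSum _ fun l _ => integrable_unitary_entries l l]
      have h1 : ∀ U : Matrix.unitaryGroup (Fin d) ℂ,
          ∑ l : Fin d, firstColumn U l * star (firstColumn U l) = 1 := by
        intro U
        have := congrFun (congrFun (Matrix.mem_unitaryGroup_iff'.mp U.2) 0) 0
        rw [Matrix.mul_apply] at this
        simpa [firstColumn, Matrix.star_apply, mul_comm] using this
      simp_rw [h1]
      simp
    rw [Finset.sum_congr rfl fun l _ => diag l i] at hsum
    simp only [Finset.sum_const, Finset.card_univ, Fintype.card_fin, nsmul_eq_mul] at hsum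
    rw [Matrix.one_apply_eq, mul_one]
    exact eq_inv_of_mul_eq_one_right hsum
  · rw [off i j hij, Matrix.one_apply_ne hij, mul_zero]

/-- The uniform POVM `{d · |u⟩⟨u| · du}`, where `du` is the law of a Haar random vector. -/
def uniformPOVM (d : ℕ) [NeZero d] : POVM (Fin d → ℂ) d where
  ref := haarVector d
  density u := (d : ℂ) • ketbra u
  posSemidef u :=
    (Matrix.posSemidef_vecMulVec_self_star u).smul (by exact_mod_cast Nat.zero_le d)
  integrable i j := by
    refine (integrable_map_measure ?_ continuous_firstColumn.measurable.aemeasurable).mpr ?_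
    · refine Continuous.aestronglyMeasurable ?_
      simp only [ketbra, Matrix.smul_apply, Matrix.vecMulVec_apply, Pi.star_apply, smul_eq_mul]
      fun_prop
    · exact (integrable_unitary_entries i j).const_mul (d : ℂ)
  integral_eq i j := by
    have hd : (d : ℂ) ≠ 0 := by exact_mod_cast NeZero.ne d
    unfold haarVector
    rw [integral_map continuous_firstColumn.measurable.aemeasurable]
    · simp only [ketbra, Matrix.smul_apply, Matrix.vecMulVec_apply, Pi.star_apply, smul_eq_mul]
      rw [integral_const_mul, integral_unitary_entries, mul_inv_cancel_left₀ hd]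
    · refine Continuous.aestronglyMeasurable ?_
      simp only [ketbra, Matrix.smul_apply, Matrix.vecMulVec_apply, Pi.star_apply, smul_eq_mul]
      fun_prop

/-! ### The moment estimator and the estimated quantities -/

/-- The single-copy estimator `(d+1)·|u⟩⟨u| - I`. -/
def singleCopyEstimator {d : ℕ} (u : Fin d → ℂ) : Matrix (Fin d) (Fin d) ℂ :=
  ((d : ℂ) + 1) • ketbra u - 1

/-- The U-statistic `Z_k` as a complex number: the average of
`tr(σ̂_{i_1} ⋯ σ̂_{i_k})` over all tuples of distinct indices `i_1, …, i_k`. -/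
def momentStatistic (k : ℕ) {d n : ℕ} (u : Fin n → Fin d → ℂ) : ℂ :=
  ((n.descFactorial k : ℕ) : ℂ)⁻¹ *
    ∑ i : Fin k ↪ Fin n,
      ((List.ofFn fun j => singleCopyEstimator (u (i j))).prod).trace

/-- The U-statistic is real, as reversing the tuple conjugates its summand. -/
theorem star_momentStatistic (k : ℕ) {d n : ℕ} (u : Fin n → Fin d → ℂ) :
    star (momentStatistic k u) = momentStatistic k u := by
  have herm : ∀ v : Fin d → ℂ,
      (singleCopyEstimator v).conjTranspose = singleCopyEstimator v := by
    intro v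
    simp [singleCopyEstimator, ketbra, Matrix.conjTranspose_vecMulVec]
  unfold momentStatistic
  rw [star_mul', star_sum]
  congr 1
  · simp
  · refine Fintype.sum_equiv
      (Equiv.embeddingCongr (Fin.revPerm : Equiv.Perm (Fin k)) (Equiv.refl (Fin n))) _ _ ?_
    intro i
    rw [← Matrix.trace_conjTranspose, Matrix.conjTranspose_list_prod]
    congr 2
    refine List.ext_getElem (by simp) fun m h1 h2 => ?_
    simp only [List.length_ofFn] at h2
    simp only [List.getElem_reverse, List.getElem_map, List.getElem_ofFn, herm, List.length_map,
      List.length_ofFn]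
    congr 2
    simp [Equiv.embeddingCongr, Fin.rev]
    have hkm : k - 1 - m = k - (m + 1) := by omega
    simp only [hkm]

/-- The `k`-moment estimator `Z_k`, a real number. -/
def momentEstimator (k : ℕ) {d n : ℕ} (u : Fin n → Fin d → ℂ) : ℝ :=
  (momentStatistic k u).re

theorem ofReal_momentEstimator (k : ℕ) {d n : ℕ} (u : Fin n → Fin d → ℂ) :
    (momentEstimator k u : ℂ) = momentStatistic k u :=
  Complex.conj_eq_iff_re.mp (star_momentStatistic k u)

/-- The `k`-th moment `tr(σ^k)`, a real number when `σ` is Hermitian. -/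
def stateMoment {d : ℕ} (σ : Matrix (Fin d) (Fin d) ℂ) (k : ℕ) : ℝ :=
  ((σ ^ k).trace).re

/-- The quantum Rényi entropy `S_k(σ) = (1/(1-k)) log tr(σ^k)`. -/
def renyiEntropy {d : ℕ} (σ : Matrix (Fin d) (Fin d) ℂ) (k : ℕ) : ℝ :=
  1 / (1 - (k : ℝ)) * Real.log (stateMoment σ k)

/-- The number of copies `max {d^{2-2/k} / δ^2, d^{3-2/k} / δ^{2/k}}`. -/
def copyBound (k d : ℕ) (δ : ℝ) : ℝ :=
  max ((d : ℝ) ^ (2 - 2 / (k : ℝ)) / δ ^ 2)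
    ((d : ℝ) ^ (3 - 2 / (k : ℝ)) / δ ^ (2 / (k : ℝ)))

end

/-! The argument is Chebyshev's inequality for a U-statistic. Write each single-copy estimator as `σ
+ Y_i`, where the `Y_i` are independent and centered, and expand the product. `Z_k - tr(σ^k)`
becomes a sum over nonempty sets `S` of positions of averages of `tr(word)`, where the word has
estimators `Y` at the positions in `S` and `σ` elsewhere (`momentEstimator_sub_stateMoment`).

The analytic input is that `Y` behaves like isotropic noise: `E|tr(AY)|² ≤ 3‖A‖²` in Frobenius norm
(`integral_normSq_trace_mul_centeredEstimator_le`), hence `E‖AYB‖² ≤ 3‖A‖²‖B‖²`. This comes from the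
second and third moments of a Haar vector and has no dimensional factor. Integrating out the
estimators of a word one at a time gives `E|tr(word)|² ≤ (3d)^|S| q^(k-|S|)`, where `q` is a power
mean of the squared eigenvalues with `d q^(k-1) = ‖σ^(k-1)‖²` (`integral_normSq_trace_evalWord_le`).

Two words are uncorrelated as soon as one of them contains an estimator missing from the other
(`integral_mul_trace_evalWord_eq_zero`). Only about an `n^(-|S|)` fraction of the pairs of tuples
survives, so the component of `S` has second moment of order `(3d/n)^|S| q^(k-|S|)`. The
intermediate sizes are dominated by the extreme ones `|S| = 1` and `|S| = k`, and the mean squared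
error is at most a constant times `‖σ^(k-1)‖²/n + (d/n)^k` (`integral_momentEstimator_sub_sq_le`).

With `M = tr(σ^k)`, the inequalities `‖σ^(k-1)‖² ≤ M² d^(2-2/k)` and `M ≥ d^(1-k)` make these errors
relative to `M²`; the two terms then produce the two terms of the copy bound. The entropy bound
holds on the same event, by Lipschitz continuity of the logarithm near `M`. -/

/-! ### Moments of a Haar random vector -/

theorem diagonal_mem_unitaryGroup {d : ℕ} {w : Fin d → ℂ} (hw : ∀ i, w i * star (w i) = 1) :
    Matrix.diagonal w ∈ Matrix.unitaryGroup (Fin d) ℂ := by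
  rw [Matrix.mem_unitaryGroup_iff, Matrix.star_eq_conjTranspose,
    Matrix.diagonal_conjTranspose, Matrix.diagonal_mul_diagonal, ← Matrix.diagonal_one]
  congr 1
  ext l
  exact hw l

theorem householder_mem_unitaryGroup {d : ℕ} {w : Fin d → ℂ} {c : ℂ} (hc : star c = c)
    (hcw : c * (star w ⬝ᵥ w) = 2) :
    1 - c • Matrix.vecMulVec w (star w) ∈ Matrix.unitaryGroup (Fin d) ℂ := by
  have hs : star (1 - c • Matrix.vecMulVec w (star w)) = 1 - c • Matrix.vecMulVec w (star w) := by
    rw [Matrix.star_eq_conjTranspose, Matrix.conjTranspose_sub, Matrix.conjTranspose_smul,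
      Matrix.conjTranspose_vecMulVec, hc]
    simp
  have hsq : Matrix.vecMulVec w (star w) * Matrix.vecMulVec w (star w)
      = (star w ⬝ᵥ w) • Matrix.vecMulVec w (star w) := by
    rw [Matrix.vecMulVec_mul_vecMulVec, Matrix.vecMulVec_smul]
  have hsq' : (c • Matrix.vecMulVec w (star w)) * (c • Matrix.vecMulVec w (star w))
      = (2 * c) • Matrix.vecMulVec w (star w) := by
    rw [smul_mul_smul_comm, hsq, smul_smul, mul_assoc, hcw, mul_comm]
  rw [Matrix.mem_unitaryGroup_iff, hs, mul_sub, sub_mul, sub_mul, hsq']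
  simp only [mul_one, one_mul]
  module

/-- Write `|3z/5 + 4w/5|² = A + B` with `A = (9|z|² + 16|w|²)/25` and `B` the cross term. Over the
four phases of `z` the odd powers of `B` average to zero and `B²` averages to `(24/25)²|z|²|w|²/2`,
which is the factor `288/625`. -/
theorem normSq_moment_four_phases (z w : ℂ) (n : ℕ) (hn : n = 2 ∨ n = 3) :
    (Complex.normSq (3 / 5 * z + 4 / 5 * w) ^ n
      + Complex.normSq (3 / 5 * (Complex.I * z) + 4 / 5 * w) ^ n
      + Complex.normSq (3 / 5 * (-z) + 4 / 5 * w) ^ n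
      + Complex.normSq (3 / 5 * (-Complex.I * z) + 4 / 5 * w) ^ n) / 4
      = ((9 * Complex.normSq z + 16 * Complex.normSq w) / 25) ^ n
        + (if n = 2 then 1 else 3 * ((9 * Complex.normSq z + 16 * Complex.normSq w) / 25))
          * (288 / 625) * (Complex.normSq z * Complex.normSq w) := by
  have e3 : (3 / 5 : ℂ) = ((3 / 5 : ℝ) : ℂ) := by norm_num
  have e4 : (4 / 5 : ℂ) = ((4 / 5 : ℝ) : ℂ) := by norm_num
  rw [e3, e4]
  rcases hn with rfl | rfl <;>
  · simp [Complex.normSq_apply]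
    ring

section HaarVector

variable {d : ℕ} [NeZero d]

theorem firstColumn_mul (V U : Matrix.unitaryGroup (Fin d) ℂ) :
    firstColumn (V * U) = V.1.mulVec (firstColumn U) := by
  ext i
  simp [firstColumn, Matrix.mul_apply, Matrix.mulVec, dotProduct]

theorem integral_haarVector {f : (Fin d → ℂ) → ℝ} (hf : Continuous f) :
    ∫ u, f u ∂haarVector d = ∫ U, f (firstColumn U) ∂haarUnitary d :=
  integral_map continuous_firstColumn.measurable.aemeasurable hf.aestronglyMeasurable

theorem Continuous.integrable_haarVector {f : (Fin d → ℂ) → ℝ} (hf : Continuous f) :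
    Integrable f (haarVector d) :=
  (integrable_map_measure hf.aestronglyMeasurable
    continuous_firstColumn.measurable.aemeasurable).mpr
    ((hf.comp continuous_firstColumn).integrable_of_hasCompactSupport
      (HasCompactSupport.of_compactSpace _))

/-- The law of a Haar random vector is invariant under unitaries. -/
theorem integral_haarVector_mulVec {f : (Fin d → ℂ) → ℝ} (hf : Continuous f)
    (V : Matrix.unitaryGroup (Fin d) ℂ) :
    ∫ u, f (V.1.mulVec u) ∂haarVector d = ∫ u, f u ∂haarVector d := by
  have hV : Continuous fun u : Fin d → ℂ => V.1.mulVec u :=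
    continuous_const.matrix_mulVec continuous_id
  rw [integral_haarVector hf, integral_haarVector (f := fun u => f (V.1.mulVec u)) (hf.comp hV)]
  simp_rw [← firstColumn_mul]
  exact integral_mul_left_eq_self (fun U => f (firstColumn U)) V

theorem sum_normSq_firstColumn (U : Matrix.unitaryGroup (Fin d) ℂ) :
    ∑ i, Complex.normSq (firstColumn U i) = 1 := by
  have := congrFun (congrFun (Matrix.mem_unitaryGroup_iff'.mp U.2) 0) 0
  rw [Matrix.mul_apply] at this
  have h : ((∑ i, Complex.normSq (firstColumn U i) : ℝ) : ℂ) = 1 := by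
    push_cast
    simpa [firstColumn, Matrix.star_apply, Complex.normSq_eq_conj_mul_self] using this
  exact_mod_cast h

theorem ae_sum_normSq_haarVector :
    ∀ᵐ u ∂haarVector d, ∑ i, Complex.normSq (u i) = 1 := by
  refine (ae_map_iff continuous_firstColumn.measurable.aemeasurable ?_).mpr
    (Filter.Eventually.of_forall sum_normSq_firstColumn)
  exact (isClosed_eq (by fun_prop) continuous_const).measurableSet

theorem integral_haarVector_phase {f : (Fin d → ℂ) → ℝ} (hf : Continuous f) (i : Fin d)
    {w : ℂ} (hw : w * star w = 1) :
    ∫ u, f (Function.update u i (w * u i)) ∂haarVector d = ∫ u, f u ∂haarVector d := by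
  have hu : Matrix.diagonal (Function.update 1 i w) ∈ Matrix.unitaryGroup (Fin d) ℂ :=
    diagonal_mem_unitaryGroup fun l => by
      by_cases h : l = i
      · subst h; simpa using hw
      · simp [h]
  rw [← integral_haarVector_mulVec hf ⟨_, hu⟩]
  congr 1
  ext u
  congr 1
  ext l
  by_cases h : l = i
  · subst h; simp [Matrix.mulVec_diagonal]
  · simp [Matrix.mulVec_diagonal, h]

theorem integral_haarVector_perm {f : (Fin d → ℂ) → ℝ} (hf : Continuous f)
    (e : Equiv.Perm (Fin d)) :
    ∫ u, f (fun l => u (e l)) ∂haarVector d = ∫ u, f u ∂haarVector d := by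
  have hP : e.permMatrix ℂ ∈ Matrix.unitaryGroup (Fin d) ℂ := by
    rw [Matrix.mem_unitaryGroup_iff, Matrix.star_eq_conjTranspose,
      Matrix.conjTranspose_permMatrix, ← Matrix.permMatrix_mul]
    simp
  rw [← integral_haarVector_mulVec hf ⟨_, hP⟩]
  congr 1
  ext u
  congr 1
  rw [Matrix.permMatrix_mulVec]
  rfl

/-- The map is the Householder reflection in `w = e_i - 2 e_j`. One map genuinely mixing two
coordinates suffices for the moments below; the triple 3, 4, 5 keeps the coefficients rational. -/
theorem integral_haarVector_rotation {f : (Fin d → ℂ) → ℝ} (hf : Continuous f) {i j : Fin d}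
    (hij : i ≠ j) :
    ∫ u, f (Function.update (Function.update u i (3 / 5 * u i + 4 / 5 * u j)) j
      (4 / 5 * u i - 3 / 5 * u j)) ∂haarVector d = ∫ u, f u ∂haarVector d := by
  set w : Fin d → ℂ := Pi.single i 1 - Pi.single j 2 with hw
  have hsw : star w = w := by
    ext l
    simp only [hw, Pi.star_apply, Pi.sub_apply, star_sub, Pi.single_apply]
    congr 1 <;> split_ifs <;> simp
  have hdot : ∀ u : Fin d → ℂ, w ⬝ᵥ u = u i - 2 * u j := by
    intro u
    rw [hw, sub_dotProduct, single_dotProduct, single_dotProduct, one_mul]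
  have hww : w ⬝ᵥ w = 5 := by
    rw [hdot]
    simp [hw, hij, hij.symm]
    norm_num
  have hV := householder_mem_unitaryGroup (w := w) (c := 2 / 5) (by simp)
    (by rw [hsw, hww]; norm_num)
  rw [← integral_haarVector_mulVec hf ⟨_, hV⟩]
  congr 1
  ext u
  congr 1
  have hmul : (1 - (2 / 5 : ℂ) • Matrix.vecMulVec w (star w)).mulVec u
      = u - (2 / 5 * (u i - 2 * u j)) • w := by
    rw [Matrix.sub_mulVec, Matrix.one_mulVec, Matrix.smul_mulVec, hsw, Matrix.vecMulVec_mulVec,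
      hdot, op_smul_eq_smul, smul_smul]
  simp only [hmul]
  ext l
  by_cases hj : l = j
  · subst hj
    simp [hw, hij.symm]
    ring
  · by_cases hi : l = i
    · subst hi
      simp [hw, hij]
      ring
    · simp [hw, hi, hj]

/-- Averaging over the phases `1, i, -1, -i` of one coordinate. -/
theorem integral_haarVector_four_phases {f : (Fin d → ℂ) → ℝ} (hf : Continuous f) (i : Fin d) :
    ∫ u, (f u + f (Function.update u i (Complex.I * u i)) + f (Function.update u i (-u i))
      + f (Function.update u i (-Complex.I * u i))) / 4 ∂haarVector d
      = ∫ u, f u ∂haarVector d := by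
  have h1 := integral_haarVector_phase hf i (w := Complex.I) (by simp)
  have h2 := integral_haarVector_phase hf i (w := -1) (by simp)
  have h3 := integral_haarVector_phase hf i (w := -Complex.I) (by simp)
  simp only [neg_one_mul] at h2
  have c1 : Continuous fun u : Fin d → ℂ => f (Function.update u i (Complex.I * u i)) := by
    fun_prop
  have c2 : Continuous fun u : Fin d → ℂ => f (Function.update u i (-u i)) := by fun_prop
  have c3 : Continuous fun u : Fin d → ℂ => f (Function.update u i (-Complex.I * u i)) := by
    fun_prop
  have i0 := hf.integrable_haarVector
  have i1 := c1.integrable_haarVector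
  have i2 := c2.integrable_haarVector
  rw [integral_div, integral_add ((i0.fun_add i1).fun_add i2) c3.integrable_haarVector,
    integral_add (i0.fun_add i1) i2, integral_add i0 i1, h1, h2, h3]
  ring

/-- The rotation identity behind all moments: `h` does not involve the coordinates `i, j`. -/
theorem integral_haarVector_mul_normSq_pow {h : (Fin d → ℂ) → ℝ} (hh : Continuous h)
    {i j : Fin d} (hij : i ≠ j) (hi : ∀ u z, h (Function.update u i z) = h u)
    (hj : ∀ u z, h (Function.update u j z) = h u) (n : ℕ) (hn : n = 2 ∨ n = 3) :
    ∫ u, h u * (((9 * Complex.normSq (u i) + 16 * Complex.normSq (u j)) / 25) ^ n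
        + (if n = 2 then 1 else 3 * ((9 * Complex.normSq (u i) + 16 * Complex.normSq (u j)) / 25))
          * (288 / 625) * (Complex.normSq (u i) * Complex.normSq (u j))) ∂haarVector d
      = ∫ u, h u * Complex.normSq (u i) ^ n ∂haarVector d := by
  have c1 : Continuous fun u : Fin d → ℂ => h u * Complex.normSq (u i) ^ n :=
    hh.mul ((Complex.continuous_normSq.comp (continuous_apply i)).pow n)
  have c2 : Continuous fun u : Fin d → ℂ =>
      h u * Complex.normSq (3 / 5 * u i + 4 / 5 * u j) ^ n :=
    hh.mul ((Complex.continuous_normSq.comp (by fun_prop)).pow n)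
  rw [← integral_haarVector_rotation c1 hij]
  simp only [hi, hj, Function.update_of_ne hij, Function.update_self]
  rw [← integral_haarVector_four_phases c2 i]
  congr 1
  ext u
  simp only [hi, Function.update_self, Function.update_of_ne hij.symm]
  rw [← normSq_moment_four_phases _ _ n hn]
  ring

theorem integral_haarVector_swap {f : (Fin d → ℂ) → ℝ} (hf : Continuous f) (i j : Fin d) :
    ∫ u, f (fun l => u (Equiv.swap i j l)) ∂haarVector d = ∫ u, f u ∂haarVector d :=
  integral_haarVector_perm hf _

/-- Rotation invariance gives a linear relation: with `X` the left integral and `Y` the one on the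
right, `X = (81 + 256)/625 X + 576/625 Y`, that is `288 X = 576 Y`. The weight `h` allows a third
coordinate to be carried along. -/
theorem integral_mul_normSq_sq {h : (Fin d → ℂ) → ℝ} (hh : Continuous h)
    {i j : Fin d} (hij : i ≠ j) (hi : ∀ u z, h (Function.update u i z) = h u)
    (hj : ∀ u z, h (Function.update u j z) = h u)
    (hs : ∀ u, h (fun l => u (Equiv.swap i j l)) = h u) :
    ∫ u, h u * Complex.normSq (u i) ^ 2 ∂haarVector d
      = 2 * ∫ u, h u * (Complex.normSq (u i) * Complex.normSq (u j)) ∂haarVector d := by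
  have hc : ∀ l : Fin d, Continuous fun u : Fin d → ℂ => Complex.normSq (u l) := fun l =>
    Complex.continuous_normSq.comp (continuous_apply l)
  have c1 : ∀ l, Continuous fun u : Fin d → ℂ => h u * Complex.normSq (u l) ^ 2 := fun l =>
    hh.mul ((hc l).pow 2)
  have c2 : Continuous fun u : Fin d → ℂ => h u * (Complex.normSq (u i) * Complex.normSq (u j)) :=
    hh.mul ((hc i).mul (hc j))
  have h1 := integral_haarVector_mul_normSq_pow hh hij hi hj 2 (Or.inl rfl)
  have h2 := integral_haarVector_swap (c1 i) i j
  simp only [hs, Equiv.swap_apply_left] at h2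
  have h3 : ∀ u : Fin d → ℂ,
      h u * (((9 * Complex.normSq (u i) + 16 * Complex.normSq (u j)) / 25) ^ 2
        + (if 2 = 2 then 1 else 3 * ((9 * Complex.normSq (u i) + 16 * Complex.normSq (u j)) / 25))
          * (288 / 625) * (Complex.normSq (u i) * Complex.normSq (u j)))
      = 81 / 625 * (h u * Complex.normSq (u i) ^ 2) + 256 / 625 * (h u * Complex.normSq (u j) ^ 2)
        + 576 / 625 * (h u * (Complex.normSq (u i) * Complex.normSq (u j))) := by
    intro u
    rw [if_pos rfl]
    ring
  replace h1 := (integral_congr_ae (Filter.Eventually.of_forall h3)).symm.trans h1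
  have j1 := (c1 i).integrable_haarVector.const_mul (81 / 625 : ℝ)
  have j2 := (c1 j).integrable_haarVector.const_mul (256 / 625 : ℝ)
  rw [integral_add (j1.fun_add j2) (c2.integrable_haarVector.const_mul _), integral_add j1 j2,
    integral_const_mul, integral_const_mul, integral_const_mul, h2] at h1
  linarith

/-- The same relation in degree three reads `15625 X = 4825 X + 32400 Y`. -/
theorem integral_normSq_cube {i j : Fin d} (hij : i ≠ j) :
    ∫ u, Complex.normSq (u i) ^ 3 ∂haarVector d
      = 3 * ∫ u, Complex.normSq (u i) ^ 2 * Complex.normSq (u j) ∂haarVector d := by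
  have hc : ∀ l : Fin d, Continuous fun u : Fin d → ℂ => Complex.normSq (u l) := fun l =>
    Complex.continuous_normSq.comp (continuous_apply l)
  have c1 : ∀ l, Continuous fun u : Fin d → ℂ => Complex.normSq (u l) ^ 3 := fun l => (hc l).pow 3
  have c2 : ∀ l m, Continuous fun u : Fin d → ℂ =>
      Complex.normSq (u l) ^ 2 * Complex.normSq (u m) := fun l m => ((hc l).pow 2).mul (hc m)
  have h1 := integral_haarVector_mul_normSq_pow (d := d) (h := fun _ => 1) continuous_const hij
    (fun _ _ => rfl) (fun _ _ => rfl) 3 (Or.inr rfl)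
  have h2 := integral_haarVector_swap (c1 i) i j
  have h4 := integral_haarVector_swap (c2 i j) i j
  simp only [Equiv.swap_apply_left, Equiv.swap_apply_right] at h2 h4
  have h3 : ∀ u : Fin d → ℂ,
      1 * (((9 * Complex.normSq (u i) + 16 * Complex.normSq (u j)) / 25) ^ 3
        + (if 3 = 2 then 1 else 3 * ((9 * Complex.normSq (u i) + 16 * Complex.normSq (u j)) / 25))
          * (288 / 625) * (Complex.normSq (u i) * Complex.normSq (u j)))
      = 729 / 15625 * Complex.normSq (u i) ^ 3 + 4096 / 15625 * Complex.normSq (u j) ^ 3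
        + 11664 / 15625 * (Complex.normSq (u i) ^ 2 * Complex.normSq (u j))
        + 20736 / 15625 * (Complex.normSq (u j) ^ 2 * Complex.normSq (u i)) := by
    intro u
    rw [if_neg (by norm_num)]
    ring
  simp_rw [h3, one_mul] at h1
  have j1 := (c1 i).integrable_haarVector.const_mul (729 / 15625 : ℝ)
  have j2 := (c1 j).integrable_haarVector.const_mul (4096 / 15625 : ℝ)
  have j3 := (c2 i j).integrable_haarVector.const_mul (11664 / 15625 : ℝ)
  have j4 := (c2 j i).integrable_haarVector.const_mul (20736 / 15625 : ℝ)
  rw [integral_add ((j1.fun_add j2).fun_add j3) j4, integral_add (j1.fun_add j2) j3, integral_add j1 j2,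
    integral_const_mul, integral_const_mul, integral_const_mul, integral_const_mul, h2, h4] at h1
  linarith

theorem sum_integral_mul_normSq {f : (Fin d → ℂ) → ℝ} (hf : Continuous f) :
    ∑ j, ∫ u, f u * Complex.normSq (u j) ∂haarVector d = ∫ u, f u ∂haarVector d := by
  have hc : ∀ j : Fin d, Continuous fun u => f u * Complex.normSq (u j) := fun j =>
    hf.mul (Complex.continuous_normSq.comp (continuous_apply j))
  rw [← integral_finsetSum _ fun j _ => (hc j).integrable_haarVector]
  refine integral_congr_ae ?_
  filter_upwards [ae_sum_normSq_haarVector] with u hu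
  rw [← Finset.mul_sum, hu, mul_one]

theorem integral_normSq_mul_normSq (i j : Fin d) :
    ∫ u, Complex.normSq (u i) * Complex.normSq (u j) ∂haarVector d
      = (if i = j then 2 else 1) / (d * (d + 1)) := by
  have hd : (0 : ℝ) < d := by exact_mod_cast Nat.pos_of_ne_zero (NeZero.ne d)
  have hc : ∀ l : Fin d, Continuous fun u : Fin d → ℂ => Complex.normSq (u l) := fun l =>
    Complex.continuous_normSq.comp (continuous_apply l)
  have first : ∀ i : Fin d, ∫ u, Complex.normSq (u i) ∂haarVector d = 1 / d := by
    intro i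
    have h1 := sum_integral_mul_normSq (d := d) (f := fun _ => 1) continuous_const
    have h2 : ∀ j : Fin d, ∫ u, Complex.normSq (u j) ∂haarVector d
        = ∫ u, Complex.normSq (u i) ∂haarVector d := by
      intro j
      have := integral_haarVector_swap (hc i) i j
      simpa using this
    simp only [one_mul, h2] at h1
    simp at h1
    rw [eq_div_iff hd.ne', mul_comm, h1]
  have pair : ∀ i j : Fin d, i ≠ j → ∫ u, Complex.normSq (u i) ^ 2 ∂haarVector d
      = 2 * ∫ u, Complex.normSq (u i) * Complex.normSq (u j) ∂haarVector d := by
    intro i j hij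
    have := integral_mul_normSq_sq (d := d) (h := fun _ => 1) continuous_const hij
      (fun _ _ => rfl) (fun _ _ => rfl) (fun _ => rfl)
    simpa using this
  have sq : ∀ i : Fin d, ∫ u, Complex.normSq (u i) ^ 2 ∂haarVector d = 2 / (d * (d + 1)) := by
    intro i
    have h1 := sum_integral_mul_normSq (hc i)
    -- Off the diagonal the mixed moment is half the square, so one formula with a diagonal
    -- correction covers all `j`. Summing it against `∑ |u_j|² = 1` determines the square, including
    -- when `d = 1`.
    have h2 : ∀ j : Fin d, ∫ u, Complex.normSq (u i) * Complex.normSq (u j) ∂haarVector d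
        = (∫ u, Complex.normSq (u i) ^ 2 ∂haarVector d) * (if j = i then 1 / 2 else 0)
          + (∫ u, Complex.normSq (u i) ^ 2 ∂haarVector d) * (1 / 2) := by
      intro j
      by_cases hij : j = i
      · subst hij
        simp only [if_true, ← sq]
        ring
      · rw [if_neg hij, pair i j (Ne.symm hij)]
        ring
    rw [Finset.sum_congr rfl fun j _ => h2 j, Finset.sum_add_distrib, ← Finset.mul_sum, first] at h1
    simp at h1
    field_simp at h1 ⊢
    linarith
  by_cases hij : i = j
  · subst hij
    simp only [if_true, ← pow_two]
    exact sq i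
  · rw [if_neg hij]
    have := pair i j hij
    rw [sq] at this
    field_simp at this ⊢
    linarith

/-- The third moments of the squared moduli of the coordinates of a Haar random vector. -/
theorem integral_normSq_mul_normSq_mul_normSq (a i j : Fin d) :
    ∫ u, Complex.normSq (u a) * (Complex.normSq (u i) * Complex.normSq (u j)) ∂haarVector d
      = (1 + (if i = j then 1 else 0) + (if a = i then 1 else 0) + (if a = j then 1 else 0)
          + (if a = i ∧ i = j then 2 else 0)) / (d * (d + 1) * (d + 2)) := by
  have hd : (0 : ℝ) < d := by exact_mod_cast Nat.pos_of_ne_zero (NeZero.ne d)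
  have hc : ∀ l : Fin d, Continuous fun u : Fin d → ℂ => Complex.normSq (u l) := fun l =>
    Complex.continuous_normSq.comp (continuous_apply l)
  have cube : ∀ i : Fin d, ∫ u, Complex.normSq (u i) ^ 3 ∂haarVector d
      = 6 / (d * (d + 1) * (d + 2)) := by
    intro i
    have h1 := sum_integral_mul_normSq (f := fun u => Complex.normSq (u i) ^ 2) ((hc i).pow 2)
    have h2 : ∀ j : Fin d, ∫ u, Complex.normSq (u i) ^ 2 * Complex.normSq (u j) ∂haarVector d
        = (∫ u, Complex.normSq (u i) ^ 3 ∂haarVector d) * (if j = i then 2 / 3 else 0)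
          + (∫ u, Complex.normSq (u i) ^ 3 ∂haarVector d) * (1 / 3) := by
      intro j
      by_cases hij : j = i
      · subst hij
        simp only [if_true, ← pow_succ]
        ring
      · rw [if_neg hij, integral_normSq_cube (Ne.symm hij)]
        ring
    have h3 := integral_normSq_mul_normSq i i
    simp only [← pow_two, if_true] at h3
    rw [Finset.sum_congr rfl fun j _ => h2 j, Finset.sum_add_distrib, ← Finset.mul_sum, h3] at h1
    simp at h1
    field_simp at h1 ⊢
    linarith
  have two : ∀ i j : Fin d, i ≠ j →
      ∫ u, Complex.normSq (u i) ^ 2 * Complex.normSq (u j) ∂haarVector d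
        = 2 / (d * (d + 1) * (d + 2)) := by
    intro i j hij
    have := integral_normSq_cube hij
    rw [cube] at this
    field_simp at this ⊢
    linarith
  by_cases hij : i = j
  · subst hij
    by_cases hai : a = i
    · subst hai
      simp only [if_true, and_self]
      refine Eq.trans ?_ ((cube a).trans (by norm_num))
      congr 1
      ext u
      ring
    · simp only [if_true, hai, if_false, false_and]
      refine Eq.trans ?_ ((two i a (Ne.symm hai)).trans (by norm_num))
      congr 1
      ext u
      ring
  · by_cases hai : a = i
    · subst hai
      simp only [if_true, hij, if_false, and_false]
      refine Eq.trans ?_ ((two a j hij).trans (by norm_num))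
      congr 1
      ext u
      ring
    · by_cases haj : a = j
      · subst haj
        simp only [hij, if_true, if_false, and_false, Ne.symm hij]
        refine Eq.trans ?_ ((two a i hai).trans (by norm_num))
        congr 1
        ext u
        ring
      · simp only [hij, hai, haj, if_false, and_false]
        -- For three distinct indices the weight is `|u_a|²`, which reduces the moment to the case
        -- of two equal indices.
        have := integral_mul_normSq_sq (hc a) hij
          (fun u z => by rw [Function.update_of_ne hai]) (fun u z => by rw [Function.update_of_ne haj])
          (fun u => by simp only [Equiv.swap_apply_of_ne_of_ne hai haj])
        have h2 := two i a (Ne.symm hai)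
        simp only [mul_comm (Complex.normSq _ ^ 2)] at h2
        rw [h2] at this
        linarith [this, show (1 + 0 + 0 + 0 + 0 : ℝ) / (d * (d + 1) * (d + 2))
          = (2 / (d * (d + 1) * (d + 2))) / 2 by ring]

end HaarVector

/-! ### Frobenius norm and expectation values -/

section Frobenius

variable {d : ℕ}

/-- The squared Frobenius norm. -/
noncomputable def frobSq (A : Matrix (Fin d) (Fin d) ℂ) : ℝ :=
  ∑ i, ∑ j, Complex.normSq (A i j)

/-- The real part of the expectation value `⟨u|H|u⟩`. -/
noncomputable def expectation (H : Matrix (Fin d) (Fin d) ℂ) (u : Fin d → ℂ) : ℝ :=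
  (star u ⬝ᵥ H.mulVec u).re

theorem frobSq_nonneg (A : Matrix (Fin d) (Fin d) ℂ) : 0 ≤ frobSq A :=
  Finset.sum_nonneg fun _ _ => Finset.sum_nonneg fun _ _ => Complex.normSq_nonneg _

theorem frobSq_eq_trace (A : Matrix (Fin d) (Fin d) ℂ) :
    frobSq A = ((A * A.conjTranspose).trace).re := by
  simp [frobSq, Matrix.trace, Matrix.mul_apply, Complex.mul_conj]

theorem continuous_frobSq : Continuous (frobSq (d := d)) := by
  unfold frobSq
  exact continuous_finsetSum _ fun i _ => continuous_finsetSum _ fun j _ =>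
    Complex.continuous_normSq.comp (continuous_id.matrix_elem i j)

theorem continuous_expectation (H : Matrix (Fin d) (Fin d) ℂ) : Continuous (expectation H) := by
  unfold expectation
  refine Complex.continuous_re.comp (Continuous.dotProduct continuous_star ?_)
  exact continuous_const.matrix_mulVec continuous_id

theorem expectation_eq_sum (H : Matrix (Fin d) (Fin d) ℂ) (u : Fin d → ℂ) :
    expectation H u = ∑ a, ∑ b, (star (u a) * (H a b * u b)).re := by
  simp [expectation, dotProduct, Matrix.mulVec, Finset.mul_sum]

theorem expectation_mulVec (H V : Matrix (Fin d) (Fin d) ℂ) (u : Fin d → ℂ) :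
    expectation H (V.mulVec u) = expectation (V.conjTranspose * H * V) u := by
  unfold expectation
  rw [Matrix.star_mulVec, ← Matrix.dotProduct_mulVec, Matrix.mulVec_mulVec, Matrix.mulVec_mulVec,
    Matrix.mul_assoc]

theorem expectation_diagonal (h : Fin d → ℝ) (u : Fin d → ℂ) :
    expectation (Matrix.diagonal fun i => (h i : ℂ)) u = ∑ i, h i * Complex.normSq (u i) := by
  simp only [expectation, dotProduct, Matrix.mulVec_diagonal, Complex.re_sum]
  refine Finset.sum_congr rfl fun i _ => ?_
  simp [Complex.normSq_apply]
  ring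

theorem trace_ketbra_mul (H : Matrix (Fin d) (Fin d) ℂ) (u : Fin d → ℂ) :
    (ketbra u * H).trace = star u ⬝ᵥ H.mulVec u := by
  rw [ketbra, Matrix.vecMulVec_mul, Matrix.trace_vecMulVec, dotProduct_comm,
    ← Matrix.dotProduct_mulVec]

theorem expectation_nonneg {H : Matrix (Fin d) (Fin d) ℂ} (hH : H.PosSemidef) (u : Fin d → ℂ) :
    0 ≤ expectation H u :=
  (Complex.nonneg_iff.mp (hH.dotProduct_mulVec_nonneg u)).1

theorem frobSq_conj_unitary (U : Matrix.unitaryGroup (Fin d) ℂ) (A : Matrix (Fin d) (Fin d) ℂ) :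
    frobSq (U.1 * A * U.1.conjTranspose) = frobSq A := by
  have hU : U.1.conjTranspose * U.1 = 1 := Matrix.mem_unitaryGroup_iff'.mp U.2
  rw [frobSq_eq_trace, frobSq_eq_trace, Matrix.conjTranspose_mul, Matrix.conjTranspose_mul,
    Matrix.conjTranspose_conjTranspose]
  have : U.1 * A * U.1.conjTranspose * (U.1 * (A.conjTranspose * U.1.conjTranspose))
      = U.1 * (A * A.conjTranspose * U.1.conjTranspose) := by
    calc _ = U.1 * A * (U.1.conjTranspose * U.1) * A.conjTranspose * U.1.conjTranspose := by
          simp only [Matrix.mul_assoc]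
      _ = _ := by rw [hU]; simp only [Matrix.mul_assoc, Matrix.one_mul]
  rw [this, Matrix.trace_mul_comm, Matrix.mul_assoc, hU, Matrix.mul_one]

theorem frobSq_diagonal (h : Fin d → ℝ) :
    frobSq (Matrix.diagonal fun i => (h i : ℂ)) = ∑ i, h i ^ 2 := by
  unfold frobSq
  refine Finset.sum_congr rfl fun i _ => ?_
  rw [Finset.sum_eq_single i (fun j _ hj => by simp [Matrix.diagonal_apply_ne _ hj.symm]) (by simp)]
  simp [pow_two]

theorem frobSq_vecMulVec (x y : Fin d → ℂ) :
    frobSq (Matrix.vecMulVec x y)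
      = (∑ i, Complex.normSq (x i)) * ∑ j, Complex.normSq (y j) := by
  simp [frobSq, Matrix.vecMulVec_apply, Finset.sum_mul_sum]

theorem spectral_decomposition {H : Matrix (Fin d) (Fin d) ℂ} (hH : H.IsHermitian) :
    H = hH.eigenvectorUnitary.1 * (Matrix.diagonal fun i => (hH.eigenvalues i : ℂ))
      * hH.eigenvectorUnitary.1.conjTranspose := by
  conv_lhs => rw [hH.spectral_theorem]
  rw [Unitary.conjStarAlgAut_apply]
  rfl

theorem continuous_sum_normSq (h : Fin d → ℝ) :
    Continuous fun u : Fin d → ℂ => ∑ i, h i * Complex.normSq (u i) :=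
  continuous_finsetSum _ fun i _ =>
    continuous_const.mul (Complex.continuous_normSq.comp (continuous_apply i))

theorem sum_normSq_phase (h : Fin d → ℝ) (u : Fin d → ℂ) (i : Fin d) :
    ∑ l, h l * Complex.normSq (Function.update u i (-u i) l)
      = ∑ l, h l * Complex.normSq (u l) := by
  refine Finset.sum_congr rfl fun l _ => ?_
  by_cases hl : l = i
  · subst hl; simp
  · simp [hl]

theorem Continuous.integrable_of_ae_mem_isCompact {α : Type*} [TopologicalSpace α]
    [MeasurableSpace α] [OpensMeasurableSpace α] {μ : Measure α} [IsFiniteMeasure μ]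
    {K : Set α} (hK : IsCompact K) (hμ : ∀ᵐ x ∂μ, x ∈ K) {f : α → ℝ} (hf : Continuous f) :
    Integrable f μ := by
  obtain ⟨c, hc⟩ := hK.exists_bound_of_continuousOn hf.continuousOn
  exact Integrable.of_bound hf.aestronglyMeasurable c (hμ.mono fun x hx => hc x hx)

theorem IsDensityMatrix.conj_unitary {σ : Matrix (Fin d) (Fin d) ℂ} (hσ : IsDensityMatrix σ)
    (U : Matrix.unitaryGroup (Fin d) ℂ) : IsDensityMatrix (U.1.conjTranspose * σ * U.1) where
  posSemidef := hσ.posSemidef.conjTranspose_mul_mul_same U.1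
  trace_eq_one := by
    have hU : U.1 * U.1.conjTranspose = 1 := Matrix.mem_unitaryGroup_iff.mp U.2
    rw [Matrix.trace_mul_comm, ← Matrix.mul_assoc, hU, Matrix.one_mul, hσ.trace_eq_one]

theorem IsDensityMatrix.diag_re_le_one {σ : Matrix (Fin d) (Fin d) ℂ} (hσ : IsDensityMatrix σ)
    (i : Fin d) : (σ i i).re ≤ 1 := by
  have h1 : ∑ i, (σ i i).re = 1 := by
    have := congrArg Complex.re hσ.trace_eq_one
    simpa [Matrix.trace] using this
  rw [← h1]
  exact Finset.single_le_sum (f := fun i => (σ i i).re)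
    (fun j _ => (Complex.nonneg_iff.mp hσ.posSemidef.diag_nonneg).1) (Finset.mem_univ i)

theorem trace_eq_sum_eigenvalues_re {H : Matrix (Fin d) (Fin d) ℂ} (hH : H.IsHermitian) :
    (H.trace).re = ∑ i, hH.eigenvalues i := by
  rw [hH.trace_eq_sum_eigenvalues]
  simp

end Frobenius

/-! ### The law of one outcome -/

section SingleCopy

variable {d : ℕ} [NeZero d]

/-- Flipping the sign of one coordinate preserves the Haar law and `f` but negates each off-diagonal
term of `⟨u|S|u⟩`, so only the diagonal of `S` survives. -/
theorem integral_expectation_mul {f : (Fin d → ℂ) → ℝ} (hf : Continuous f)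
    (hphase : ∀ u i, f (Function.update u i (-u i)) = f u) (S : Matrix (Fin d) (Fin d) ℂ) :
    ∫ u, expectation S u * f u ∂haarVector d
      = ∑ a, (S a a).re * ∫ u, Complex.normSq (u a) * f u ∂haarVector d := by
  have hc : ∀ a b : Fin d, Continuous fun u : Fin d → ℂ =>
      (star (u a) * (S a b * u b)).re * f u := fun a b => by fun_prop
  have hi := fun a b => (hc a b).integrable_haarVector
  simp_rw [expectation_eq_sum, Finset.sum_mul]
  rw [integral_finsetSum _ fun a _ => integrable_finsetSum _ fun b _ => hi a b]
  refine Finset.sum_congr rfl fun a _ => ?_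
  rw [integral_finsetSum _ fun b _ => hi a b,
    Finset.sum_eq_single a, ← integral_const_mul]
  · congr 1
    ext u
    simp [Complex.normSq_apply]
    ring
  · intro b _ hb
    have h := integral_haarVector_phase (hc a b) a (w := -1) (by simp)
    have e : ∀ u : Fin d → ℂ, f (Function.update u a (-1 * u a)) = f u := fun u => by
      rw [neg_one_mul, hphase]
    simp only [e, Function.update_self, Function.update_of_ne hb] at h
    simp only [neg_mul, one_mul, star_neg, Complex.neg_re, integral_neg] at h
    linarith
  · simp

theorem integral_expectation_mul_diagonal {S : Matrix (Fin d) (Fin d) ℂ} (hS : S.trace = 1)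
    (h : Fin d → ℝ) :
    ∫ u, expectation S u * ∑ i, h i * Complex.normSq (u i) ∂haarVector d
      = (∑ i, h i + ∑ i, (S i i).re * h i) / (d * (d + 1)) := by
  have hS' : ∑ i, (S i i).re = 1 := by
    have := congrArg Complex.re hS
    simpa [Matrix.trace] using this
  have hc : ∀ l : Fin d, Continuous fun u : Fin d → ℂ => Complex.normSq (u l) := fun l =>
    Complex.continuous_normSq.comp (continuous_apply l)
  have key : ∀ a : Fin d,
      ∫ u, Complex.normSq (u a) * ∑ i, h i * Complex.normSq (u i) ∂haarVector d
        = (∑ i, h i + h a) / (d * (d + 1)) := by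
    intro a
    have e : ∀ u : Fin d → ℂ, Complex.normSq (u a) * ∑ i, h i * Complex.normSq (u i)
        = ∑ i, h i * (Complex.normSq (u a) * Complex.normSq (u i)) := by
      intro u
      rw [Finset.mul_sum]
      exact Finset.sum_congr rfl fun i _ => by ring
    simp_rw [e]
    have hi : ∀ i, Integrable (fun u : Fin d → ℂ =>
        h i * (Complex.normSq (u a) * Complex.normSq (u i))) (haarVector d) :=
      fun i => ((hc a).mul (hc i)).integrable_haarVector.const_mul (h i)
    rw [integral_finsetSum _ fun i _ => hi i]
    simp_rw [integral_const_mul, integral_normSq_mul_normSq]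
    have e2 : ∀ i : Fin d, h i * ((if a = i then 2 else 1) / ((d : ℝ) * (d + 1)))
        = (h i + if a = i then h i else 0) / ((d : ℝ) * (d + 1)) := by
      intro i
      split_ifs <;> ring
    rw [Finset.sum_congr rfl fun i _ => e2 i, ← Finset.sum_div, Finset.sum_add_distrib]
    simp
  rw [integral_expectation_mul (continuous_sum_normSq h) (fun u i => sum_normSq_phase h u i)]
  simp_rw [key, ← mul_div_assoc, mul_add]
  rw [← Finset.sum_div, Finset.sum_add_distrib, ← Finset.sum_mul, hS', one_mul]

/-- Tracelessness removes every term of the third-moment formula that leaves some `h i` summed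
alone. What remains are the diagonal squares, which is why no dimensional factor multiplies the
Frobenius norm later. -/
theorem integral_expectation_mul_diagonal_sq {S : Matrix (Fin d) (Fin d) ℂ} (hS : S.trace = 1)
    (h : Fin d → ℝ) (h0 : ∑ i, h i = 0) :
    ∫ u, expectation S u * (∑ i, h i * Complex.normSq (u i)) ^ 2 ∂haarVector d
      = (∑ i, h i ^ 2 + 2 * ∑ i, (S i i).re * h i ^ 2) / (d * (d + 1) * (d + 2)) := by
  have hS' : ∑ i, (S i i).re = 1 := by
    have := congrArg Complex.re hS
    simpa [Matrix.trace] using this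
  have hc : ∀ l : Fin d, Continuous fun u : Fin d → ℂ => Complex.normSq (u l) := fun l =>
    Complex.continuous_normSq.comp (continuous_apply l)
  have key : ∀ a : Fin d,
      ∫ u, Complex.normSq (u a) * (∑ i, h i * Complex.normSq (u i)) ^ 2 ∂haarVector d
        = (∑ i, h i ^ 2 + 2 * h a ^ 2) / (d * (d + 1) * (d + 2)) := by
    intro a
    have e : ∀ u : Fin d → ℂ, Complex.normSq (u a) * (∑ i, h i * Complex.normSq (u i)) ^ 2
        = ∑ i, ∑ j, h i * h j *
          (Complex.normSq (u a) * (Complex.normSq (u i) * Complex.normSq (u j))) := by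
      intro u
      rw [pow_two, Finset.sum_mul_sum, Finset.mul_sum]
      refine Finset.sum_congr rfl fun i _ => ?_
      rw [Finset.mul_sum]
      exact Finset.sum_congr rfl fun j _ => by ring
    have hi : ∀ i j, Integrable (fun u : Fin d → ℂ => h i * h j *
        (Complex.normSq (u a) * (Complex.normSq (u i) * Complex.normSq (u j)))) (haarVector d) :=
      fun i j => ((hc a).mul ((hc i).mul (hc j))).integrable_haarVector.const_mul _
    simp_rw [e]
    rw [integral_finsetSum _ fun i _ => integrable_finsetSum _ fun j _ => hi i j]
    have e1 : ∀ i : Fin d, ∫ u, ∑ j, h i * h j *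
          (Complex.normSq (u a) * (Complex.normSq (u i) * Complex.normSq (u j))) ∂haarVector d
        = (h i ^ 2 + (if a = i then 2 * h i ^ 2 else 0) + h i * h a)
          / (d * (d + 1) * (d + 2)) := by
      intro i
      rw [integral_finsetSum _ fun j _ => hi i j]
      simp_rw [integral_const_mul, integral_normSq_mul_normSq_mul_normSq]
      have e2 : ∀ j : Fin d, h i * h j * ((1 + (if i = j then 1 else 0) + (if a = i then 1 else 0)
          + (if a = j then 1 else 0) + (if a = i ∧ i = j then 2 else 0)) /
            ((d : ℝ) * (d + 1) * (d + 2)))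
          = (h i * (1 + if a = i then 1 else 0) * h j + (if i = j then h i * h j else 0)
            + (if a = j then h i * h j else 0) +
            (if i = j then (if a = i then 2 * h i * h j else 0) else 0))
              / ((d : ℝ) * (d + 1) * (d + 2)) := by
        intro j
        by_cases h1 : i = j <;> by_cases h2 : a = i <;> by_cases h3 : a = j <;>
          simp only [h1, h2, h3, if_true, if_false, and_self, and_true, and_false] <;> ring
      rw [Finset.sum_congr rfl fun j _ => e2 j, ← Finset.sum_div, Finset.sum_add_distrib,
        Finset.sum_add_distrib, Finset.sum_add_distrib, ← Finset.mul_sum, h0]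
      simp only [Finset.sum_ite_eq, Finset.mem_univ, if_true]
      congr 1
      split_ifs <;> ring
    rw [Finset.sum_congr rfl fun i _ => e1 i, ← Finset.sum_div, Finset.sum_add_distrib,
      Finset.sum_add_distrib, ← Finset.sum_mul, h0]
    simp
  rw [integral_expectation_mul (f := fun u => (∑ i, h i * Complex.normSq (u i)) ^ 2)
    ((continuous_sum_normSq h).pow 2)
    (fun u i => by simp only [sum_normSq_phase])]
  simp_rw [key, ← mul_div_assoc, mul_add]
  rw [← Finset.sum_div, Finset.sum_add_distrib, ← Finset.sum_mul, hS', one_mul, Finset.mul_sum]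
  congr 2
  exact Finset.sum_congr rfl fun i _ => by ring

theorem integral_outcome {σ : Matrix (Fin d) (Fin d) ℂ} (hσ : IsDensityMatrix σ)
    (f : (Fin d → ℂ) → ℝ) :
    ∫ u, f u ∂(uniformPOVM d).outcome σ = d * ∫ u, expectation σ u * f u ∂haarVector d := by
  have hdens : ∀ u : Fin d → ℂ, (((uniformPOVM d).density u * σ).trace).re
      = d * expectation σ u := by
    intro u
    simp only [uniformPOVM, Matrix.smul_mul, Matrix.trace_smul, trace_ketbra_mul, expectation,
      smul_eq_mul]
    simp
  have hnn : ∀ u, 0 ≤ (d : ℝ) * expectation σ u := fun u =>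
    mul_nonneg (Nat.cast_nonneg d) (expectation_nonneg hσ.posSemidef u)
  unfold POVM.outcome
  simp_rw [hdens]
  rw [integral_withDensity_eq_integral_toReal_smul₀]
  · simp_rw [ENNReal.toReal_ofReal (hnn _), smul_eq_mul, mul_assoc]
    rw [integral_const_mul]
    rfl
  · exact (continuous_const.mul (continuous_expectation σ)).measurable.ennreal_ofReal.aemeasurable
  · exact Filter.Eventually.of_forall fun _ => ENNReal.ofReal_lt_top

theorem ae_sum_normSq_outcome (σ : Matrix (Fin d) (Fin d) ℂ) :
    ∀ᵐ u ∂(uniformPOVM d).outcome σ, ∑ i, Complex.normSq (u i) = 1 :=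
  (withDensity_absolutelyContinuous (haarVector d) _).ae_le ae_sum_normSq_haarVector

theorem ae_mem_closedBall_outcome (σ : Matrix (Fin d) (Fin d) ℂ) :
    ∀ᵐ u ∂(uniformPOVM d).outcome σ, u ∈ Metric.closedBall (0 : Fin d → ℂ) 1 := by
  filter_upwards [ae_sum_normSq_outcome σ] with u hu
  rw [mem_closedBall_zero_iff, pi_norm_le_iff_of_nonneg zero_le_one]
  intro i
  have h1 : Complex.normSq (u i) ≤ 1 := hu ▸
    Finset.single_le_sum (f := fun i => Complex.normSq (u i))
      (fun j _ => Complex.normSq_nonneg (u j)) (Finset.mem_univ i)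
  rw [Complex.normSq_eq_norm_sq] at h1
  nlinarith [norm_nonneg (u i)]

theorem Continuous.integrable_outcome {σ : Matrix (Fin d) (Fin d) ℂ} (hσ : IsDensityMatrix σ)
    {f : (Fin d → ℂ) → ℝ} (hf : Continuous f) : Integrable f ((uniformPOVM d).outcome σ) := by
  have := (uniformPOVM d).isProbabilityMeasure_outcome hσ
  exact hf.integrable_of_ae_mem_isCompact (isCompact_closedBall 0 1) (ae_mem_closedBall_outcome σ)

/-- Unitary invariance of the Haar vector permits working in an eigenbasis of `H`. The state is
conjugated and need not become diagonal, but only its diagonal will matter by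
`integral_expectation_mul`. -/
theorem integral_expectation_outcome_diagonalize {σ H : Matrix (Fin d) (Fin d) ℂ}
    (hσ : IsDensityMatrix σ) (hH : H.IsHermitian) {g : ℝ → ℝ} (hg : Continuous g) :
    ∫ u, g (expectation H u) ∂(uniformPOVM d).outcome σ
      = d * ∫ u, expectation (hH.eigenvectorUnitary.1.conjTranspose * σ * hH.eigenvectorUnitary.1) u
          * g (∑ i, hH.eigenvalues i * Complex.normSq (u i)) ∂haarVector d := by
  have hU : hH.eigenvectorUnitary.1.conjTranspose * hH.eigenvectorUnitary.1 = 1 :=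
    Matrix.mem_unitaryGroup_iff'.mp hH.eigenvectorUnitary.2
  rw [integral_outcome hσ, ← integral_haarVector_mulVec (f := fun u => expectation σ u * g (expectation H u))
    ((continuous_expectation σ).mul (hg.comp (continuous_expectation H))) hH.eigenvectorUnitary]
  congr 2
  ext u
  simp only [expectation_mulVec]
  congr 2
  rw [← expectation_diagonal]
  congr 1
  have cancel : ∀ A V D : Matrix (Fin d) (Fin d) ℂ, A = V * D * V.conjTranspose →
      V.conjTranspose * V = 1 → V.conjTranspose * A * V = D := by
    rintro A V D rfl hV
    simp only [Matrix.mul_assoc, hV, Matrix.mul_one]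
    rw [← Matrix.mul_assoc, hV, Matrix.one_mul]
  exact cancel _ _ _ (spectral_decomposition hH) hU

theorem integral_expectation_outcome {σ H : Matrix (Fin d) (Fin d) ℂ}
    (hσ : IsDensityMatrix σ) (hH : H.IsHermitian) :
    ∫ u, expectation H u ∂(uniformPOVM d).outcome σ
      = ((H.trace).re + ((H * σ).trace).re) / (d + 1) := by
  have hd : (0 : ℝ) < d := by exact_mod_cast Nat.pos_of_ne_zero (NeZero.ne d)
  have h := integral_expectation_outcome_diagonalize hσ hH continuous_id
  simp only [id] at h
  rw [h, integral_expectation_mul_diagonal (hσ.conj_unitary _).trace_eq_one,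
    trace_eq_sum_eigenvalues_re hH]
  have h2 : ((H * σ).trace).re = ∑ i, ((hH.eigenvectorUnitary.1.conjTranspose * σ *
      hH.eigenvectorUnitary.1) i i).re * hH.eigenvalues i := by
    conv_lhs => rw [spectral_decomposition hH]
    rw [Matrix.mul_assoc, Matrix.mul_assoc, Matrix.trace_mul_comm, Matrix.mul_assoc, Matrix.trace]
    simp only [Matrix.diag_apply, Matrix.diagonal_mul, Complex.re_sum, Complex.re_ofReal_mul]
    exact Finset.sum_congr rfl fun i _ => mul_comm _ _
  rw [h2]
  field_simp

/-- The factor 3 is `1 + 2`: the diagonal entries of the rotated state are at most 1, so the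
state-dependent term is at most `2‖H‖²`. -/
theorem integral_expectation_sq_outcome_le {σ H : Matrix (Fin d) (Fin d) ℂ}
    (hσ : IsDensityMatrix σ) (hH : H.IsHermitian) (h0 : H.trace = 0) :
    ∫ u, expectation H u ^ 2 ∂(uniformPOVM d).outcome σ ≤ 3 * frobSq H / (d + 1) ^ 2 := by
  have hd : (0 : ℝ) < d := by exact_mod_cast Nat.pos_of_ne_zero (NeZero.ne d)
  have h1 : ∑ i, hH.eigenvalues i = 0 := by
    rw [← trace_eq_sum_eigenvalues_re hH, h0, Complex.zero_re]
  have h2 : frobSq H = ∑ i, hH.eigenvalues i ^ 2 := by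
    conv_lhs => rw [spectral_decomposition hH]
    rw [frobSq_conj_unitary, frobSq_diagonal]
  have hS := hσ.conj_unitary hH.eigenvectorUnitary
  rw [integral_expectation_outcome_diagonalize hσ hH (continuous_pow 2),
    integral_expectation_mul_diagonal_sq hS.trace_eq_one _ h1]
  have h3 : ∑ i, ((hH.eigenvectorUnitary.1.conjTranspose * σ *
      hH.eigenvectorUnitary.1) i i).re * hH.eigenvalues i ^ 2 ≤ frobSq H := by
    rw [h2]
    exact Finset.sum_le_sum fun i _ =>
      mul_le_of_le_one_left (sq_nonneg _) (hS.diag_re_le_one i)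
  have h4 := frobSq_nonneg H
  rw [← h2]
  calc _ ≤ (d : ℝ) * ((3 * frobSq H) / (d * (d + 1) * (d + 2))) := by
        gcongr
        linarith
    _ = 3 * frobSq H / ((d + 1) * (d + 2)) := by field_simp
    _ ≤ _ := by
        gcongr
        nlinarith

end SingleCopy

/-! ### The centered single-copy estimator -/

section Centered

variable {d : ℕ}

/-- The single-copy estimator minus the state. -/
noncomputable def centeredEstimator (σ : Matrix (Fin d) (Fin d) ℂ) (u : Fin d → ℂ) :
    Matrix (Fin d) (Fin d) ℂ :=
  singleCopyEstimator u - σ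

theorem continuous_ketbra : Continuous (ketbra (d := d)) := by
  refine continuous_matrix fun i j => ?_
  simp only [ketbra, Matrix.vecMulVec_apply, Pi.star_apply]
  fun_prop

theorem continuous_centeredEstimator (σ : Matrix (Fin d) (Fin d) ℂ) :
    Continuous (centeredEstimator σ) := by
  unfold centeredEstimator singleCopyEstimator
  have h : Continuous fun u : Fin d → ℂ => ((d : ℂ) + 1) • ketbra u :=
    (continuous_const_smul _).comp continuous_ketbra
  exact (h.sub continuous_const).sub continuous_const

theorem isHermitian_centeredEstimator {σ : Matrix (Fin d) (Fin d) ℂ} (hσ : σ.IsHermitian)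
    (u : Fin d → ℂ) : (centeredEstimator σ u).IsHermitian := by
  unfold Matrix.IsHermitian centeredEstimator singleCopyEstimator ketbra
  rw [Matrix.conjTranspose_sub, hσ.eq]
  simp [Matrix.conjTranspose_vecMulVec]

theorem trace_mul_centeredEstimator_re (σ H : Matrix (Fin d) (Fin d) ℂ) (u : Fin d → ℂ) :
    ((H * centeredEstimator σ u).trace).re
      = (d + 1) * expectation H u - (H.trace).re - ((H * σ).trace).re := by
  have h : (H * centeredEstimator σ u).trace
      = ((d + 1 : ℝ) : ℂ) * (star u ⬝ᵥ H.mulVec u) - H.trace - (H * σ).trace := by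
    unfold centeredEstimator singleCopyEstimator
    rw [Matrix.mul_sub, Matrix.mul_sub, Matrix.mul_one, Matrix.trace_sub, Matrix.trace_sub,
      Matrix.mul_smul, Matrix.trace_smul, Matrix.trace_mul_comm, trace_ketbra_mul, smul_eq_mul]
    push_cast
    rfl
  rw [h, Complex.sub_re, Complex.sub_re, Complex.re_ofReal_mul]
  rfl

theorem trace_mul_im_eq_zero {A B : Matrix (Fin d) (Fin d) ℂ} (hA : A.IsHermitian)
    (hB : B.IsHermitian) : ((A * B).trace).im = 0 := by
  rw [← Complex.conj_eq_iff_im, starRingEnd_apply, ← Matrix.trace_conjTranspose,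
    Matrix.conjTranspose_mul, hA.eq, hB.eq, Matrix.trace_mul_comm]

/-- The Cartesian decomposition is orthogonal in Frobenius norm, so second-moment bounds for
Hermitian test matrices extend to all matrices with the same constant. -/
theorem exists_hermitian_decomposition (A : Matrix (Fin d) (Fin d) ℂ) :
    ∃ H K : Matrix (Fin d) (Fin d) ℂ, H.IsHermitian ∧ K.IsHermitian ∧ A = H + Complex.I • K ∧
      frobSq H + frobSq K = frobSq A := by
  have hI : Complex.I * (-Complex.I / 2) = 1 / 2 := by
    rw [← mul_div_assoc, mul_neg, Complex.I_mul_I, neg_neg]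
  refine ⟨(1 / 2 : ℂ) • (A + A.conjTranspose), (-Complex.I / 2) • (A - A.conjTranspose),
    ?_, ?_, ?_, ?_⟩
  · ext i j
    simp
    ring
  · ext i j
    simp
    ring
  · rw [smul_smul, hI]
    module
  · have h : ∀ z w : ℂ, Complex.normSq ((1 / 2) * (z + w)) + Complex.normSq ((-Complex.I / 2) * (z - w))
        = (Complex.normSq z + Complex.normSq w) / 2 := by
      intro z w
      simp only [map_mul, map_div₀, Complex.normSq_neg, Complex.normSq_I, Complex.normSq_one,
        Complex.normSq_add, Complex.normSq_sub, Complex.normSq_ofNat]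
      ring
    unfold frobSq
    simp only [← Finset.sum_add_distrib, Matrix.smul_apply, Matrix.add_apply, Matrix.sub_apply,
      Matrix.conjTranspose_apply, smul_eq_mul, h]
    simp only [← Finset.sum_div, Finset.sum_add_distrib]
    rw [Finset.sum_comm (f := fun i j => Complex.normSq (star (A j i)))]
    simp

theorem expectation_sub_smul_one (H : Matrix (Fin d) (Fin d) ℂ) (c : ℝ) {u : Fin d → ℂ}
    (hu : ∑ i, Complex.normSq (u i) = 1) :
    expectation (H - (c : ℂ) • 1) u = expectation H u - c := by
  have h : star u ⬝ᵥ u = 1 := by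
    have : ((∑ i, Complex.normSq (u i) : ℝ) : ℂ) = 1 := by rw [hu]; simp
    rw [← this]
    push_cast
    exact Finset.sum_congr rfl fun i _ => by simp [Complex.normSq_eq_conj_mul_self]
  unfold expectation
  rw [Matrix.sub_mulVec, dotProduct_sub, Matrix.smul_mulVec, Matrix.one_mulVec, dotProduct_smul, h]
  simp

variable [NeZero d]

/-- This is unbiasedness of the single-copy estimator. The part `i K` of `A` contributes nothing to
the real part, because the trace of a product of two Hermitian matrices is real. -/
theorem integral_trace_mul_centeredEstimator {σ : Matrix (Fin d) (Fin d) ℂ}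
    (hσ : IsDensityMatrix σ) (A : Matrix (Fin d) (Fin d) ℂ) :
    ∫ u, ((A * centeredEstimator σ u).trace).re ∂(uniformPOVM d).outcome σ = 0 := by
  have := (uniformPOVM d).isProbabilityMeasure_outcome hσ
  obtain ⟨H, K, hH, hK, rfl, -⟩ := exists_hermitian_decomposition A
  have h : ∀ u, (((H + Complex.I • K) * centeredEstimator σ u).trace).re
      = (d + 1) * expectation H u - ((H.trace).re + ((H * σ).trace).re) := by
    intro u
    rw [Matrix.add_mul, Matrix.trace_add, Complex.add_re, Matrix.smul_mul, Matrix.trace_smul,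
      smul_eq_mul, Complex.I_mul_re,
      trace_mul_im_eq_zero hK (isHermitian_centeredEstimator hσ.posSemidef.isHermitian u),
      trace_mul_centeredEstimator_re]
    ring
  have hd : (d : ℝ) + 1 ≠ 0 := by positivity
  simp_rw [h]
  rw [integral_sub (((continuous_expectation H).integrable_outcome hσ).const_mul _)
    (integrable_const _), integral_const_mul, integral_expectation_outcome hσ hH, integral_const,
    mul_div_cancel₀ _ hd]
  simp

/-- Removing the trace is the orthogonal projection onto traceless matrices; the norm drops by
exactly `c² d`. -/
theorem frobSq_sub_trace_le {H : Matrix (Fin d) (Fin d) ℂ} (hH : H.IsHermitian) :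
    frobSq (H - (((H.trace).re / d : ℝ) : ℂ) • 1) ≤ frobSq H := by
  have hd : (0 : ℝ) < d := by exact_mod_cast Nat.pos_of_ne_zero (NeZero.ne d)
  set c : ℝ := (H.trace).re / d with hc
  have hct : (H.trace).re = c * d := by rw [hc]; field_simp
  have hH' : (H - (c : ℂ) • 1).conjTranspose = H - (c : ℂ) • 1 := by
    rw [Matrix.conjTranspose_sub, hH.eq, Matrix.conjTranspose_smul, Matrix.conjTranspose_one]
    simp
  rw [frobSq_eq_trace, frobSq_eq_trace, hH', hH.eq]
  have h : ((H - (c : ℂ) • 1) * (H - (c : ℂ) • 1)).trace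
      = (H * H).trace - ((2 * c : ℝ) : ℂ) * H.trace + ((c ^ 2 * d : ℝ) : ℂ) := by
    simp only [sub_mul, mul_sub, Matrix.smul_mul, Matrix.mul_smul, Matrix.trace_sub,
      Matrix.trace_smul, Matrix.mul_one, Matrix.one_mul, Matrix.trace_one, Fintype.card_fin,
      smul_eq_mul]
    push_cast
    ring
  rw [h, Complex.add_re, Complex.sub_re, Complex.re_ofReal_mul, Complex.ofReal_re, hct]
  nlinarith [sq_nonneg c]

/-- The centered estimator is almost surely traceless, so `H` may be replaced by its traceless part
`H₀`. Then the integral is the variance of `(d+1)⟨u|H₀|u⟩`, whose mean is `b`, and it is bounded by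
the raw second moment. -/
theorem integral_trace_mul_centeredEstimator_sq_le_of_isHermitian
    {σ H : Matrix (Fin d) (Fin d) ℂ} (hσ : IsDensityMatrix σ) (hH : H.IsHermitian) :
    ∫ u, ((H * centeredEstimator σ u).trace).re ^ 2 ∂(uniformPOVM d).outcome σ
      ≤ 3 * frobSq H := by
  have := (uniformPOVM d).isProbabilityMeasure_outcome hσ
  have hd : (0 : ℝ) < d := by exact_mod_cast Nat.pos_of_ne_zero (NeZero.ne d)
  set c : ℝ := (H.trace).re / d with hc
  set H₀ := H - (c : ℂ) • (1 : Matrix (Fin d) (Fin d) ℂ) with hH₀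
  have hH₀' : H₀.IsHermitian := by
    unfold Matrix.IsHermitian
    rw [hH₀, Matrix.conjTranspose_sub, hH.eq, Matrix.conjTranspose_smul, Matrix.conjTranspose_one]
    simp
  have ht : H₀.trace = 0 := by
    have him : (H.trace).im = 0 := by
      simpa using trace_mul_im_eq_zero hH (Matrix.isHermitian_one (n := Fin d) (α := ℂ))
    rw [hH₀, Matrix.trace_sub, Matrix.trace_smul, Matrix.trace_one, Fintype.card_fin, hc]
    apply Complex.ext
    · simp
    · simp [him]
  set b : ℝ := ((H₀ * σ).trace).re with hb
  have e : ∀ᵐ u ∂(uniformPOVM d).outcome σ, ((H * centeredEstimator σ u).trace).re ^ 2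
      = (d + 1) ^ 2 * expectation H₀ u ^ 2 + -(2 * b) * ((d + 1) * expectation H₀ u) + b ^ 2 := by
    filter_upwards [ae_sum_normSq_outcome σ] with u hu
    have h1 : ((H * σ).trace).re = b + c := by
      rw [hb, hH₀, Matrix.sub_mul, Matrix.trace_sub, Matrix.smul_mul, Matrix.trace_smul,
        Matrix.one_mul, hσ.trace_eq_one]
      simp
    have h2 : (H.trace).re = c * d := by rw [hc]; field_simp
    rw [trace_mul_centeredEstimator_re, hH₀, expectation_sub_smul_one H c hu, h1, h2]
    ring
  have i1 := ((continuous_expectation H₀).integrable_outcome hσ)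
  have i2 : Integrable (fun u => expectation H₀ u ^ 2) ((uniformPOVM d).outcome σ) :=
    Continuous.integrable_outcome hσ ((continuous_expectation H₀).pow 2)
  rw [integral_congr_ae e, integral_add ((i2.const_mul _).fun_add ((i1.const_mul _).const_mul _))
    (integrable_const _), integral_add (i2.const_mul _) ((i1.const_mul _).const_mul _),
    integral_const_mul, integral_const_mul, integral_const_mul,
    integral_expectation_outcome hσ hH₀', ht, ← hb, integral_const]
  have hd1 : (d : ℝ) + 1 ≠ 0 := by positivity
  have h3 := integral_expectation_sq_outcome_le hσ hH₀' ht
  rw [le_div_iff₀ (by positivity)] at h3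
  have h4 := frobSq_sub_trace_le hH
  rw [mul_div_cancel₀ _ hd1]
  simp only [Complex.zero_re, zero_add, probReal_univ, smul_eq_mul, one_mul]
  nlinarith [sq_nonneg b]

/-- The covariance of the single-copy estimator is dominated by the Frobenius norm. -/
theorem integral_normSq_trace_mul_centeredEstimator_le {σ : Matrix (Fin d) (Fin d) ℂ}
    (hσ : IsDensityMatrix σ) (A : Matrix (Fin d) (Fin d) ℂ) :
    ∫ u, Complex.normSq (A * centeredEstimator σ u).trace ∂(uniformPOVM d).outcome σ
      ≤ 3 * frobSq A := by
  obtain ⟨H, K, hH, hK, rfl, hfrob⟩ := exists_hermitian_decomposition A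
  have hc : ∀ B : Matrix (Fin d) (Fin d) ℂ,
      Continuous fun u => ((B * centeredEstimator σ u).trace).re ^ 2 := fun B =>
    (Complex.continuous_re.comp
      (continuous_const.matrix_mul (continuous_centeredEstimator σ)).matrix_trace).pow 2
  -- Both traces are real, so they are the real and imaginary parts of the trace of the whole.
  have h : ∀ u, Complex.normSq ((H + Complex.I • K) * centeredEstimator σ u).trace
      = ((H * centeredEstimator σ u).trace).re ^ 2
        + ((K * centeredEstimator σ u).trace).re ^ 2 := by
    intro u
    have hY := isHermitian_centeredEstimator hσ.posSemidef.isHermitian u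
    rw [Matrix.add_mul, Matrix.trace_add, Matrix.smul_mul, Matrix.trace_smul, smul_eq_mul,
      Complex.normSq_apply]
    simp [trace_mul_im_eq_zero hH hY, trace_mul_im_eq_zero hK hY]
    ring
  simp_rw [h]
  rw [integral_add ((hc H).integrable_outcome hσ) ((hc K).integrable_outcome hσ), ← hfrob]
  linarith [integral_trace_mul_centeredEstimator_sq_le_of_isHermitian hσ hH,
    integral_trace_mul_centeredEstimator_sq_le_of_isHermitian hσ hK]

/-- Each entry of `A Y B` is the trace of `Y` against a rank-one matrix built from a row of `A` and
a column of `B`, so the scalar bound applies entry by entry and the norms multiply. -/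
theorem integral_frobSq_mul_centeredEstimator_mul_le {σ : Matrix (Fin d) (Fin d) ℂ}
    (hσ : IsDensityMatrix σ) (A B : Matrix (Fin d) (Fin d) ℂ) :
    ∫ u, frobSq (A * centeredEstimator σ u * B) ∂(uniformPOVM d).outcome σ
      ≤ 3 * (frobSq A * frobSq B) := by
  have hentry : ∀ u i j, (A * centeredEstimator σ u * B) i j
      = (Matrix.vecMulVec (fun l => B l j) (A i) * centeredEstimator σ u).trace := by
    intro u i j
    rw [Matrix.vecMulVec_mul, Matrix.trace_vecMulVec, Matrix.mul_apply, dotProduct]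
    exact Finset.sum_congr rfl fun l _ => mul_comm _ _
  have hc : ∀ C : Matrix (Fin d) (Fin d) ℂ,
      Continuous fun u => Complex.normSq (C * centeredEstimator σ u).trace := fun C =>
    Complex.continuous_normSq.comp
      (continuous_const.matrix_mul (continuous_centeredEstimator σ)).matrix_trace
  have hi := fun C => (hc C).integrable_outcome hσ
  have e : ∀ u, frobSq (A * centeredEstimator σ u * B) = ∑ i, ∑ j,
      Complex.normSq (Matrix.vecMulVec (fun l => B l j) (A i) * centeredEstimator σ u).trace := by
    intro u
    unfold frobSq
    simp_rw [hentry]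
  simp_rw [e]
  rw [integral_finsetSum _ fun i _ => integrable_finsetSum _ fun j _ => hi _]
  have hAB : 3 * (frobSq A * frobSq B)
      = ∑ i, ∑ j, 3 * frobSq (Matrix.vecMulVec (fun l => B l j) (A i)) := by
    simp_rw [frobSq_vecMulVec, ← Finset.mul_sum, ← Finset.sum_mul]
    rw [← Finset.mul_sum, mul_comm (frobSq A)]
    congr 2
    exact Finset.sum_comm
  rw [hAB]
  refine Finset.sum_le_sum fun i _ => ?_
  rw [integral_finsetSum _ fun j _ => hi _]
  exact Finset.sum_le_sum fun j _ => integral_normSq_trace_mul_centeredEstimator_le hσ _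

end Centered

/-! ### Moments of the spectrum of a state -/

section Spectrum

/-- The power mean inequality for the uniform weights. It bounds all lower moments by powers of a
single number, so that factors coming from different runs of `σ` in a word combine by adding
exponents. -/
theorem sum_pow_le_card_mul_rpow {ι : Type*} [Fintype ι] [Nonempty ι] {l : ι → ℝ}
    (hl : ∀ i, 0 ≤ l i) {N a : ℕ} (haN : a ≤ N) :
    ∑ i, l i ^ a ≤ Fintype.card ι
      * (((∑ i, l i ^ N) / Fintype.card ι) ^ (1 / (N : ℝ))) ^ a := by
  rcases Nat.eq_zero_or_pos a with rfl | ha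
  · simp
  have hc : (0 : ℝ) < Fintype.card ι := by exact_mod_cast Fintype.card_pos
  have ha' : (0 : ℝ) < a := by exact_mod_cast ha
  have hN' : (0 : ℝ) < N := by exact_mod_cast ha.trans_le haN
  have hp : 1 ≤ (N : ℝ) / a := by
    rw [one_le_div ha']
    exact_mod_cast haN
  have h := Real.rpow_arith_mean_le_arith_mean_rpow Finset.univ
    (fun _ : ι => 1 / (Fintype.card ι : ℝ)) (fun i => l i ^ a) (fun _ _ => by positivity)
    (by simp) (fun i _ => pow_nonneg (hl i) a) hp
  have e : ∀ i, (l i ^ a) ^ ((N : ℝ) / a) = l i ^ N := by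
    intro i
    rw [← Real.rpow_natCast (l i) a, ← Real.rpow_mul (hl i), mul_div_cancel₀ _ ha'.ne',
      Real.rpow_natCast]
  simp only [e, ← Finset.mul_sum] at h
  have hS : 0 ≤ ∑ i, l i ^ a := Finset.sum_nonneg fun i _ => pow_nonneg (hl i) a
  have h2 := Real.rpow_le_rpow (by positivity) h (by positivity : 0 ≤ (a : ℝ) / N)
  rw [← Real.rpow_mul (by positivity), div_mul_div_cancel₀ ha'.ne', div_self hN'.ne',
    Real.rpow_one] at h2
  have hT : 0 ≤ ∑ i, l i ^ N := Finset.sum_nonneg fun i _ => pow_nonneg (hl i) N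
  rw [← Real.rpow_natCast (_ ^ (1 / (N : ℝ))), ← Real.rpow_mul (by positivity), one_div_mul_eq_div,
    ← div_le_iff₀' hc]
  simpa [div_eq_inv_mul] using h2

variable {d : ℕ}

theorem trace_pow_eq_sum_eigenvalues {H : Matrix (Fin d) (Fin d) ℂ} (hH : H.IsHermitian) (p : ℕ) :
    ((H ^ p).trace).re = ∑ i, hH.eigenvalues i ^ p := by
  have hU : hH.eigenvectorUnitary.1.conjTranspose * hH.eigenvectorUnitary.1 = 1 :=
    Matrix.mem_unitaryGroup_iff'.mp hH.eigenvectorUnitary.2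
  conv_lhs => rw [hH.spectral_theorem]
  rw [← map_pow, Matrix.diagonal_pow, Unitary.conjStarAlgAut_apply, Matrix.mul_assoc,
    Matrix.trace_mul_comm, Matrix.mul_assoc]
  erw [hU]
  rw [Matrix.mul_one, Matrix.trace_diagonal]
  simp [← Complex.ofReal_pow]

theorem frobSq_pow_eq_sum_eigenvalues {H : Matrix (Fin d) (Fin d) ℂ} (hH : H.IsHermitian)
    (a : ℕ) : frobSq (H ^ a) = ∑ i, hH.eigenvalues i ^ (2 * a) := by
  rw [frobSq_eq_trace, (hH.pow a).eq, ← pow_add, ← two_mul, trace_pow_eq_sum_eigenvalues hH]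

variable [NeZero d] {σ : Matrix (Fin d) (Fin d) ℂ}

theorem IsDensityMatrix.frobSq_pow_le (hσ : IsDensityMatrix σ) {N a : ℕ} (haN : a ≤ N) :
    frobSq (σ ^ a) ≤ d * ((frobSq (σ ^ N) / d) ^ (1 / (N : ℝ))) ^ a := by
  have hH := hσ.posSemidef.isHermitian
  rw [frobSq_pow_eq_sum_eigenvalues hH, frobSq_pow_eq_sum_eigenvalues hH]
  have := sum_pow_le_card_mul_rpow (fun i => sq_nonneg (hH.eigenvalues i)) haN
  simpa only [← pow_mul, Fintype.card_fin] using this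

/-- By the power mean inequality the maximally mixed state minimizes `tr(σ^k)`. This lower bound
turns absolute errors into relative ones. -/
theorem IsDensityMatrix.one_le_mul_stateMoment (hσ : IsDensityMatrix σ) {k : ℕ} (hk : 1 ≤ k) :
    1 ≤ (d : ℝ) ^ (k - 1) * stateMoment σ k := by
  have hd : (0 : ℝ) < d := by exact_mod_cast Nat.pos_of_ne_zero (NeZero.ne d)
  have hH := hσ.posSemidef.isHermitian
  have h1 : ∑ i, hH.eigenvalues i = 1 := by
    rw [← trace_eq_sum_eigenvalues_re hH, hσ.trace_eq_one, Complex.one_re]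
  obtain ⟨n, rfl⟩ := Nat.exists_eq_add_of_le' hk
  have h2 := pow_sum_le_card_mul_sum_pow (s := Finset.univ)
    (fun i _ => hσ.posSemidef.eigenvalues_nonneg i) n
  rw [show ∑ i, hσ.posSemidef.isHermitian.eigenvalues i = 1 from h1, one_pow, Finset.card_univ, Fintype.card_fin] at h2
  rw [Nat.add_sub_cancel, stateMoment, trace_pow_eq_sum_eigenvalues hH]
  exact h2

theorem IsDensityMatrix.stateMoment_pos (hσ : IsDensityMatrix σ) {k : ℕ} (hk : 1 ≤ k) :
    0 < stateMoment σ k := by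
  have hd : (0 : ℝ) < d := by exact_mod_cast Nat.pos_of_ne_zero (NeZero.ne d)
  have h := hσ.one_le_mul_stateMoment hk
  by_contra hn
  nlinarith [pow_pos hd (k - 1)]

/-- With `M = tr(σ^k)`, every eigenvalue is at most `M^(1/k)`, so `∑ λ^(2k-2) ≤ M · M^((k-2)/k) =
M^(2-2/k)`. The missing factor `M^(2/k)` is paid for by `d^(k-1) M ≥ 1` raised to the power `2/k`.
-/
theorem IsDensityMatrix.frobSq_pow_pred_le (hσ : IsDensityMatrix σ) {k : ℕ} (hk : 2 ≤ k) :
    frobSq (σ ^ (k - 1)) ≤ stateMoment σ k ^ 2 * (d : ℝ) ^ (2 - 2 / (k : ℝ)) := by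
  have hd : (0 : ℝ) < d := by exact_mod_cast Nat.pos_of_ne_zero (NeZero.ne d)
  have hk0 : (0 : ℝ) < k := by positivity
  have hH := hσ.posSemidef.isHermitian
  have hl : ∀ i, 0 ≤ hH.eigenvalues i := hσ.posSemidef.eigenvalues_nonneg
  have hM := hσ.stateMoment_pos (k := k) (by omega)
  have hMeq : stateMoment σ k = ∑ i, hH.eigenvalues i ^ k := trace_pow_eq_sum_eigenvalues hH k
  have hle : ∀ i, hH.eigenvalues i ^ (k - 2) ≤ stateMoment σ k ^ (((k - 2 : ℕ) : ℝ) / k) := by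
    intro i
    have h1 : hH.eigenvalues i ^ k ≤ stateMoment σ k := hMeq ▸
      Finset.single_le_sum (f := fun i => hH.eigenvalues i ^ k)
        (fun j _ => pow_nonneg (hl j) k) (Finset.mem_univ i)
    calc hH.eigenvalues i ^ (k - 2)
        = (hH.eigenvalues i ^ k) ^ (((k - 2 : ℕ) : ℝ) / k) := by
          rw [← Real.rpow_natCast _ k, ← Real.rpow_mul (hl i), mul_div_cancel₀ _ hk0.ne',
            Real.rpow_natCast]
      _ ≤ _ := Real.rpow_le_rpow (pow_nonneg (hl i) k) h1 (by positivity)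
  have h1 : frobSq (σ ^ (k - 1))
      ≤ stateMoment σ k * stateMoment σ k ^ (((k - 2 : ℕ) : ℝ) / k) := by
    rw [frobSq_pow_eq_sum_eigenvalues hH]
    nth_rewrite 1 [hMeq]
    rw [Finset.sum_mul]
    refine Finset.sum_le_sum fun i _ => ?_
    rw [show 2 * (k - 1) = k + (k - 2) by omega, pow_add]
    exact mul_le_mul_of_nonneg_left (hle i) (pow_nonneg (hl i) k)
  refine h1.trans ?_
  rw [pow_two, mul_assoc]
  refine mul_le_mul_of_nonneg_left ?_ hM.le
  have h2 : 1 ≤ ((d : ℝ) ^ (k - 1) * stateMoment σ k) ^ (2 / (k : ℝ)) :=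
    Real.one_le_rpow (hσ.one_le_mul_stateMoment (by omega)) (by positivity)
  have e1 : ((d : ℝ) ^ (k - 1) * stateMoment σ k) ^ (2 / (k : ℝ))
      = (d : ℝ) ^ (2 - 2 / (k : ℝ)) * stateMoment σ k ^ (2 / (k : ℝ)) := by
    rw [Real.mul_rpow (by positivity) hM.le, ← Real.rpow_natCast (d : ℝ), ← Real.rpow_mul hd.le]
    congr 2
    rw [Nat.cast_sub (by omega)]
    field_simp
    push_cast
    ring
  have e2 : stateMoment σ k ^ (((k - 2 : ℕ) : ℝ) / k) * stateMoment σ k ^ (2 / (k : ℝ))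
      = stateMoment σ k := by
    rw [← Real.rpow_add hM, Nat.cast_sub hk]
    conv_rhs => rw [← Real.rpow_one (stateMoment σ k)]
    congr 1
    field_simp
    push_cast
    ring
  rw [e1] at h2
  calc _ ≤ stateMoment σ k ^ (((k - 2 : ℕ) : ℝ) / k) *
        ((d : ℝ) ^ (2 - 2 / (k : ℝ)) * stateMoment σ k ^ (2 / (k : ℝ))) :=
        le_mul_of_one_le_right (Real.rpow_nonneg hM.le _) h2
    _ = (stateMoment σ k ^ (((k - 2 : ℕ) : ℝ) / k) * stateMoment σ k ^ (2 / (k : ℝ)))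
        * (d : ℝ) ^ (2 - 2 / (k : ℝ)) := by ring
    _ = _ := by rw [e2]

end Spectrum

/-! ### Resampling one coordinate of a product measure -/

section Resampling

variable {Ω : Type*} [MeasurableSpace Ω] {μ : Measure Ω} [IsProbabilityMeasure μ] {n : ℕ}

/-- Redrawing one coordinate independently leaves a product law unchanged. This is the form of
Fubini used to integrate out one estimator while the others stay fixed. -/
theorem measurePreserving_update (m : Fin n) :
    MeasurePreserving (fun p : (Fin n → Ω) × Ω => Function.update p.1 m p.2)
      ((Measure.pi fun _ => μ).prod μ) (Measure.pi fun _ => μ) := by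
  refine ⟨measurable_update', (Measure.pi_eq fun s hs => ?_).symm⟩
  rw [Measure.map_apply measurable_update' (MeasurableSet.univ_pi hs)]
  have hset : (fun p : (Fin n → Ω) × Ω => Function.update p.1 m p.2) ⁻¹' Set.univ.pi s
      = (Set.univ.pi (Function.update s m Set.univ)) ×ˢ s m := by
    ext p
    simp only [Set.mem_preimage, Set.mem_pi, Set.mem_univ, true_implies, Set.mem_prod]
    constructor
    · refine fun h => ⟨fun i => ?_, by simpa using h m⟩
      by_cases hi : i = m
      · subst hi; simp
      · simpa [hi] using h i
    · rintro ⟨h, hm⟩ i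
      by_cases hi : i = m
      · subst hi; simpa using hm
      · simpa [hi] using h i
  rw [hset, Measure.prod_prod, Measure.pi_pi, ← Finset.mul_prod_erase _ _ (Finset.mem_univ m),
    ← Finset.mul_prod_erase _ (fun i => μ (s i)) (Finset.mem_univ m), Function.update_self,
    measure_univ, one_mul, mul_comm]
  congr 1
  exact Finset.prod_congr rfl fun i hi => by rw [Function.update_of_ne (Finset.ne_of_mem_erase hi)]

theorem integral_pi_resample {f : (Fin n → Ω) → ℝ} (hf : Integrable f (Measure.pi fun _ => μ))
    (m : Fin n) :
    ∫ u, f u ∂(Measure.pi fun _ => μ)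
      = ∫ u, ∫ x, f (Function.update u m x) ∂μ ∂(Measure.pi fun _ => μ) := by
  have hmp := measurePreserving_update (μ := μ) m
  rw [← hmp.map_eq] at hf
  have h := integral_map hmp.measurable.aemeasurable hf.aestronglyMeasurable
  rw [hmp.map_eq] at h
  exact h.trans (integral_prod _ (hf.comp_measurable hmp.measurable))

theorem integral_pi_le_of_resample {f g : (Fin n → Ω) → ℝ}
    (hf : Integrable f (Measure.pi fun _ => μ)) (hg : Integrable g (Measure.pi fun _ => μ))
    (m : Fin n) (h : ∀ u, ∫ x, f (Function.update u m x) ∂μ ≤ g u) :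
    ∫ u, f u ∂(Measure.pi fun _ => μ) ≤ ∫ u, g u ∂(Measure.pi fun _ => μ) := by
  have hmp := measurePreserving_update (μ := μ) m
  rw [integral_pi_resample hf m]
  rw [← hmp.map_eq] at hf
  exact integral_mono (hf.comp_measurable hmp.measurable).integral_prod_left hg h

end Resampling

/-! ### Products of centered estimators and states -/

section Words

variable {d n : ℕ} (σ : Matrix (Fin d) (Fin d) ℂ)

/-- The letter `none` stands for the state, `some m` for the `m`-th centered estimator. -/
noncomputable def letter (u : Fin n → Fin d → ℂ) : Option (Fin n) → Matrix (Fin d) (Fin d) ℂ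
  | none => σ
  | some m => centeredEstimator σ (u m)

/-- The product of the letters of a word. -/
noncomputable def evalWord (u : Fin n → Fin d → ℂ) (w : List (Option (Fin n))) :
    Matrix (Fin d) (Fin d) ℂ :=
  (w.map (letter σ u)).prod

/-- No estimator occurs twice in the word. -/
def DistinctWord (w : List (Option (Fin n))) : Prop :=
  w.Pairwise fun x y => ∀ m, x = some m → y ≠ some m

/-- The weight of a letter in the second-moment bounds. -/
noncomputable def letterWeight (d : ℕ) (q : ℝ) : Option (Fin n) → ℝ
  | none => q
  | some _ => 3 * d

theorem letterWeight_nonneg {q : ℝ} (hq : 0 ≤ q) (x : Option (Fin n)) :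
    0 ≤ letterWeight d q x := by
  cases x
  · exact hq
  · simp only [letterWeight]; positivity

theorem prod_letterWeight_nonneg {q : ℝ} (hq : 0 ≤ q) (w : List (Option (Fin n))) :
    0 ≤ (w.map (letterWeight d q)).prod :=
  List.prod_nonneg fun x hx => by
    obtain ⟨y, -, rfl⟩ := List.mem_map.mp hx
    exact letterWeight_nonneg hq y

theorem continuous_evalWord (w : List (Option (Fin n))) :
    Continuous fun u : Fin n → Fin d → ℂ => evalWord σ u w := by
  induction w with
  | nil => exact continuous_const
  | cons x w ih =>
    have hx : Continuous fun u : Fin n → Fin d → ℂ => letter σ u x := by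
      cases x with
      | none => exact continuous_const
      | some m => exact (continuous_centeredEstimator σ).comp (continuous_apply m)
    simpa [evalWord] using hx.matrix_mul ih

variable {σ}

theorem evalWord_update {w : List (Option (Fin n))} {m : Fin n} (h : some m ∉ w)
    (u : Fin n → Fin d → ℂ) (x : Fin d → ℂ) :
    evalWord σ (Function.update u m x) w = evalWord σ u w := by
  unfold evalWord
  congr 1
  refine List.map_congr_left fun y hy => ?_
  cases y with
  | none => rfl
  | some l =>
    have hl : l ≠ m := fun e => h (e ▸ hy)
    simp [letter, Function.update_of_ne hl]

theorem DistinctWord.notMem {w : List (Option (Fin n))} {m : Fin n}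
    (h : DistinctWord (some m :: w)) : some m ∉ w := fun hm =>
  (List.pairwise_cons.mp h).1 _ hm m rfl rfl

variable [NeZero d]

theorem Continuous.integrable_outcomeCopies (hσ : IsDensityMatrix σ)
    {f : (Fin n → Fin d → ℂ) → ℝ} (hf : Continuous f) :
    Integrable f ((uniformPOVM d).outcomeCopies σ n) := by
  have := (uniformPOVM d).isProbabilityMeasure_outcome hσ
  have hK : ∀ᵐ u ∂(uniformPOVM d).outcomeCopies σ n,
      u ∈ Metric.closedBall (0 : Fin n → Fin d → ℂ) 1 := by
    have h : ∀ i : Fin n, ∀ᵐ u ∂(uniformPOVM d).outcomeCopies σ n,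
        u i ∈ Metric.closedBall (0 : Fin d → ℂ) 1 := fun i =>
      (Measure.quasiMeasurePreserving_eval (fun _ : Fin n => (uniformPOVM d).outcome σ) i).ae
        (ae_mem_closedBall_outcome σ)
    filter_upwards [ae_all_iff.mpr h] with u hu
    rw [mem_closedBall_zero_iff, pi_norm_le_iff_of_nonneg zero_le_one]
    exact fun i => mem_closedBall_zero_iff.mp (hu i)
  have : IsFiniteMeasure ((uniformPOVM d).outcomeCopies σ n) := by
    unfold POVM.outcomeCopies
    infer_instance
  exact hf.integrable_of_ae_mem_isCompact (isCompact_closedBall 0 1) hK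

/-- Induction from the left: `a` collects the states met so far, and `b` is a fixed power at the
right end, needed when a trace is rotated cyclically. The length condition ensures that no power of
`σ` beyond `N` ever appears. -/
theorem integral_frobSq_evalWord_le (hσ : IsDensityMatrix σ) {q : ℝ} (hq : 0 ≤ q) {N : ℕ}
    (hN : ∀ a ≤ N, frobSq (σ ^ a) ≤ d * q ^ a) {w : List (Option (Fin n))}
    (hw : DistinctWord w) {a b : ℕ} (hab : a + b + w.length ≤ N) :
    ∫ u, frobSq (σ ^ a * evalWord σ u w * σ ^ b) ∂(uniformPOVM d).outcomeCopies σ n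
      ≤ d * q ^ (a + b) * (w.map (letterWeight d q)).prod := by
  have := (uniformPOVM d).isProbabilityMeasure_outcome hσ
  have hν : IsProbabilityMeasure ((uniformPOVM d).outcomeCopies σ n) := by
    unfold POVM.outcomeCopies
    infer_instance
  have hcont : ∀ (a : ℕ) (w : List (Option (Fin n))), Continuous fun u =>
      frobSq (σ ^ a * evalWord σ u w * σ ^ b) := fun a w =>
    continuous_frobSq.comp
      ((continuous_const.matrix_mul (continuous_evalWord σ w)).matrix_mul continuous_const)
  induction w generalizing a with
  | nil =>
    simp only [evalWord, List.map_nil, List.prod_nil, mul_one, ← pow_add, integral_const,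
      probReal_univ, one_smul]
    exact hN _ (by simpa using hab)
  | cons x w ih =>
    have hw' : DistinctWord w := (List.pairwise_cons.mp hw).2
    rw [List.length_cons] at hab
    cases x with
    | none =>
      have e : ∀ u : Fin n → Fin d → ℂ, σ ^ a * evalWord σ u (none :: w) * σ ^ b
          = σ ^ (a + 1) * evalWord σ u w * σ ^ b := by
        intro u
        simp only [evalWord, List.map_cons, List.prod_cons, letter, pow_succ, Matrix.mul_assoc]
      simp_rw [e]
      refine (ih hw' (a := a + 1) (by omega)).trans_eq ?_
      simp only [List.map_cons, List.prod_cons, letterWeight]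
      ring
    | some m =>
      have hm := hw.notMem
      -- Integrating out the first estimator splits the word there. The left piece `σ^a` contributes
      -- `3 d q^a`, which accounts for the weight `3d` of an estimator letter; the right piece
      -- starts afresh with exponent 0.
      have h1 : ∫ u, frobSq (σ ^ a * evalWord σ u (some m :: w) * σ ^ b)
            ∂(uniformPOVM d).outcomeCopies σ n
          ≤ ∫ u, 3 * frobSq (σ ^ a) * frobSq (σ ^ 0 * evalWord σ u w * σ ^ b)
            ∂(uniformPOVM d).outcomeCopies σ n := by
        refine integral_pi_le_of_resample ((hcont a (some m :: w)).integrable_outcomeCopies hσ)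
          (((hcont 0 w).integrable_outcomeCopies hσ).const_mul _) m fun u => ?_
        have e : ∀ x, σ ^ a * evalWord σ (Function.update u m x) (some m :: w) * σ ^ b
            = σ ^ a * centeredEstimator σ x * (σ ^ 0 * evalWord σ u w * σ ^ b) := by
          intro x
          have := evalWord_update (σ := σ) hm u x
          unfold evalWord at this ⊢
          simp only [List.map_cons, List.prod_cons, letter, this, Function.update_self, pow_zero,
            Matrix.one_mul, Matrix.mul_assoc]
        simp_rw [e, mul_assoc (3 : ℝ)]
        exact integral_frobSq_mul_centeredEstimator_mul_le hσ _ _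
      refine h1.trans ?_
      rw [integral_const_mul]
      have h2 := ih hw' (a := 0) (by omega)
      have h3 := hN a (by omega)
      have h4 := prod_letterWeight_nonneg (d := d) hq w
      calc _ ≤ 3 * (d * q ^ a) * (d * q ^ (0 + b) * (w.map (letterWeight d q)).prod) := by
            gcongr
            exact integral_nonneg fun _ => frobSq_nonneg _
        _ = _ := by
            simp only [List.map_cons, List.prod_cons, letterWeight]
            ring

/-- Leading states are absorbed into `a` until the first estimator, which is integrated out by the
scalar bound. Cyclicity of the trace moves `σ^a` to the right end of what remains. The estimator
itself uses up one letter, so length `N + 1` is allowed, and the prefactor `d` of the Frobenius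
bound goes into its weight. -/
theorem integral_normSq_trace_evalWord_le (hσ : IsDensityMatrix σ) {q : ℝ} (hq : 0 ≤ q) {N : ℕ}
    (hN : ∀ a ≤ N, frobSq (σ ^ a) ≤ d * q ^ a) {w : List (Option (Fin n))}
    (hw : DistinctWord w) (hne : ∃ m, some m ∈ w) {a : ℕ} (ha : a + w.length ≤ N + 1) :
    ∫ u, Complex.normSq (σ ^ a * evalWord σ u w).trace ∂(uniformPOVM d).outcomeCopies σ n
      ≤ q ^ a * (w.map (letterWeight d q)).prod := by
  have := (uniformPOVM d).isProbabilityMeasure_outcome hσ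
  induction w generalizing a with
  | nil => simp at hne
  | cons x w ih =>
    have hw' : DistinctWord w := (List.pairwise_cons.mp hw).2
    rw [List.length_cons] at ha
    cases x with
    | none =>
      have e : ∀ u : Fin n → Fin d → ℂ, σ ^ a * evalWord σ u (none :: w)
          = σ ^ (a + 1) * evalWord σ u w := by
        intro u
        simp only [evalWord, List.map_cons, List.prod_cons, letter, pow_succ, Matrix.mul_assoc]
      simp_rw [e]
      refine (ih hw' (by simpa using hne) (a := a + 1) (by omega)).trans_eq ?_
      simp only [List.map_cons, List.prod_cons, letterWeight]
      ring
    | some m =>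
      have hm := hw.notMem
      have c1 : Continuous fun u : Fin n → Fin d → ℂ =>
          Complex.normSq (σ ^ a * evalWord σ u (some m :: w)).trace :=
        Complex.continuous_normSq.comp
          (continuous_const.matrix_mul (continuous_evalWord σ _)).matrix_trace
      have c2 : Continuous fun u : Fin n → Fin d → ℂ =>
          frobSq (σ ^ 0 * evalWord σ u w * σ ^ a) :=
        continuous_frobSq.comp
          ((continuous_const.matrix_mul (continuous_evalWord σ w)).matrix_mul continuous_const)
      have h1 : ∫ u, Complex.normSq (σ ^ a * evalWord σ u (some m :: w)).trace
            ∂(uniformPOVM d).outcomeCopies σ n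
          ≤ ∫ u, 3 * frobSq (σ ^ 0 * evalWord σ u w * σ ^ a)
            ∂(uniformPOVM d).outcomeCopies σ n := by
        refine integral_pi_le_of_resample (c1.integrable_outcomeCopies hσ)
          ((c2.integrable_outcomeCopies hσ).const_mul _) m fun u => ?_
        have e : ∀ x, (σ ^ a * evalWord σ (Function.update u m x) (some m :: w)).trace
            = ((σ ^ 0 * evalWord σ u w * σ ^ a) * centeredEstimator σ x).trace := by
          intro x
          have := evalWord_update (σ := σ) hm u x
          unfold evalWord at this ⊢
          simp only [List.map_cons, List.prod_cons, letter, this, Function.update_self, pow_zero,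
            Matrix.one_mul]
          rw [← Matrix.mul_assoc, Matrix.trace_mul_comm, Matrix.mul_assoc]
        simp_rw [e]
        exact integral_normSq_trace_mul_centeredEstimator_le hσ _
      refine h1.trans ?_
      rw [integral_const_mul]
      have h2 := integral_frobSq_evalWord_le hσ hq hN hw' (a := 0) (b := a) (by omega)
      refine (mul_le_mul_of_nonneg_left h2 (by norm_num)).trans_eq ?_
      simp only [List.map_cons, List.prod_cons, letterWeight]
      ring

/-- The `m`-th estimator occurs exactly once in `w` and not in `v`, so with the other outcomes fixed
the product is linear in that centered estimator, and its mean vanishes. -/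
theorem integral_mul_trace_evalWord_eq_zero (hσ : IsDensityMatrix σ)
    {v w : List (Option (Fin n))} (hw : DistinctWord w) {m : Fin n} (hm : some m ∈ w)
    (hv : some m ∉ v) :
    ∫ u, ((evalWord σ u v).trace).re * ((evalWord σ u w).trace).re
      ∂(uniformPOVM d).outcomeCopies σ n = 0 := by
  have := (uniformPOVM d).isProbabilityMeasure_outcome hσ
  obtain ⟨w₁, w₂, rfl⟩ := List.append_of_mem hm
  have h1 := List.pairwise_append.mp hw
  have hm₂ : some m ∉ w₂ := DistinctWord.notMem h1.2.1
  have hm₁ : some m ∉ w₁ := fun h => h1.2.2 _ h _ List.mem_cons_self m rfl rfl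
  have hc : ∀ w : List (Option (Fin n)), Continuous fun u : Fin n → Fin d → ℂ =>
      ((evalWord σ u w).trace).re := fun w =>
    Complex.continuous_re.comp (continuous_evalWord σ w).matrix_trace
  unfold POVM.outcomeCopies
  rw [integral_pi_resample (f := fun u => ((evalWord σ u v).trace).re *
    ((evalWord σ u (w₁ ++ some m :: w₂)).trace).re) (((hc v).mul (hc _)).integrable_outcomeCopies hσ) m]
  have h0 : ∀ u : Fin n → Fin d → ℂ, ∫ x, ((evalWord σ (Function.update u m x) v).trace).re *
      ((evalWord σ (Function.update u m x) (w₁ ++ some m :: w₂)).trace).re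
        ∂(uniformPOVM d).outcome σ = 0 := by
    intro u
    have e : ∀ x, (evalWord σ (Function.update u m x) (w₁ ++ some m :: w₂)).trace
        = ((evalWord σ u w₂ * evalWord σ u w₁) * centeredEstimator σ x).trace := by
      intro x
      have e1 := evalWord_update (σ := σ) hm₁ u x
      have e2 := evalWord_update (σ := σ) hm₂ u x
      unfold evalWord at e1 e2 ⊢
      simp only [List.map_append, List.prod_append, List.map_cons, List.prod_cons, letter, e1, e2,
        Function.update_self]
      rw [← Matrix.mul_assoc, Matrix.trace_mul_comm, Matrix.mul_assoc]
    simp_rw [evalWord_update hv, e]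
    rw [integral_const_mul, integral_trace_mul_centeredEstimator hσ, mul_zero]
  simp_rw [h0]
  simp

end Words

/-! ### Variance of the moment estimator -/

section Variance

variable {d n k : ℕ}

/-- The word with estimators at the positions in `S` and the state elsewhere. -/
def tupleWord (S : Finset (Fin k)) (i : Fin k ↪ Fin n) : List (Option (Fin n)) :=
  List.ofFn fun j => if j ∈ S then some (i j) else none

theorem mem_tupleWord {S : Finset (Fin k)} {i : Fin k ↪ Fin n} {m : Fin n} :
    some m ∈ tupleWord S i ↔ m ∈ S.map i := by
  simp only [tupleWord, List.mem_ofFn, Finset.mem_map]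
  constructor
  · rintro ⟨j, hj⟩
    split_ifs at hj with h
    exact ⟨j, h, Option.some.inj hj⟩
  · rintro ⟨j, h, rfl⟩
    exact ⟨j, by rw [if_pos h]⟩

theorem distinctWord_tupleWord (S : Finset (Fin k)) (i : Fin k ↪ Fin n) :
    DistinctWord (tupleWord S i) := by
  refine List.pairwise_ofFn.mpr fun j l hjl m h1 h2 => ?_
  split_ifs at h1 h2
  exact hjl.ne (i.injective ((Option.some.inj h1).trans (Option.some.inj h2).symm))

theorem prod_letterWeight_tupleWord (q : ℝ) (S : Finset (Fin k)) (i : Fin k ↪ Fin n) :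
    ((tupleWord S i).map (letterWeight d q)).prod = (3 * d) ^ S.card * q ^ (k - S.card) := by
  have e : ∀ j, letterWeight d q (if j ∈ S then some (i j) else none)
      = if j ∈ S then 3 * (d : ℝ) else q := by
    intro j
    split_ifs <;> rfl
  rw [tupleWord, List.map_ofFn, List.prod_ofFn]
  simp only [Function.comp_apply, e]
  rw [Finset.prod_ite, Finset.prod_const, Finset.prod_const, Finset.filter_not]
  simp [Finset.card_sdiff]

theorem prod_singleCopyEstimator_eq_sum (σ : Matrix (Fin d) (Fin d) ℂ) (u : Fin n → Fin d → ℂ)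
    (i : Fin k ↪ Fin n) :
    (List.ofFn fun j => singleCopyEstimator (u (i j))).prod
      = ∑ S, evalWord σ u (tupleWord S i) := by
  have h := (MultilinearMap.mkPiAlgebraFin ℂ k (Matrix (Fin d) (Fin d) ℂ)).map_add_univ
    (fun j => centeredEstimator σ (u (i j))) (fun _ => σ)
  simp only [MultilinearMap.mkPiAlgebraFin_apply] at h
  have e : (fun j => singleCopyEstimator (u (i j)))
      = (fun j => centeredEstimator σ (u (i j))) + fun _ => σ := by
    ext1 j
    simp [centeredEstimator]
  rw [e, h]
  refine Finset.sum_congr rfl fun S _ => ?_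
  rw [evalWord, tupleWord, List.map_ofFn]
  congr 2
  ext1 j
  by_cases hj : j ∈ S <;> simp [hj, letter]

/-- The component of the moment estimator with estimators at the positions in `S`. -/
noncomputable def momentComponent (σ : Matrix (Fin d) (Fin d) ℂ) (S : Finset (Fin k))
    (u : Fin n → Fin d → ℂ) : ℝ :=
  ((n.descFactorial k : ℕ) : ℝ)⁻¹ *
    ∑ i : Fin k ↪ Fin n, ((evalWord σ u (tupleWord S i)).trace).re

/-- The empty set of positions contributes `tr(σ^k)` exactly. The identity is purely algebraic and
holds for every matrix `σ`. -/
theorem momentEstimator_sub_stateMoment (σ : Matrix (Fin d) (Fin d) ℂ) (hkn : k ≤ n)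
    (u : Fin n → Fin d → ℂ) :
    momentEstimator k u - stateMoment σ k
      = ∑ S ∈ Finset.univ.erase (∅ : Finset (Fin k)), momentComponent σ S u := by
  have hD : ((n.descFactorial k : ℕ) : ℝ) ≠ 0 := by
    exact_mod_cast fun h => (Nat.descFactorial_eq_zero_iff_lt.mp h).not_ge hkn
  have h0 : momentComponent σ (∅ : Finset (Fin k)) u = stateMoment σ k := by
    have e : ∀ i : Fin k ↪ Fin n, evalWord σ u (tupleWord ∅ i) = σ ^ k := by
      intro i
      simp [evalWord, tupleWord, letter, List.ofFn_const]
    simp only [momentComponent, e, Finset.sum_const, Finset.card_univ, Fintype.card_embedding_eq,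
      Fintype.card_fin, nsmul_eq_mul]
    rw [inv_mul_cancel_left₀ hD]
    rfl
  have h1 : momentEstimator k u = ∑ S : Finset (Fin k), momentComponent σ S u := by
    unfold momentEstimator momentStatistic momentComponent
    simp_rw [prod_singleCopyEstimator_eq_sum σ, Matrix.trace_sum]
    rw [Finset.sum_comm, Finset.mul_sum, Complex.re_sum]
    refine Finset.sum_congr rfl fun S _ => ?_
    rw [← Complex.ofReal_natCast, ← Complex.ofReal_inv, Complex.re_ofReal_mul, Complex.re_sum]
  rw [h1, ← Finset.add_sum_erase _ _ (Finset.mem_univ ∅), h0, add_sub_cancel_left]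

/-- This counts the tuples that can be correlated with `i`. Dropping injectivity, each position in
`S` has `|S|` choices and each other position has `n`. -/
theorem card_embedding_map_subset_le (S : Finset (Fin k)) (i : Fin k ↪ Fin n) :
    (Finset.univ.filter fun i' : Fin k ↪ Fin n => ∀ j ∈ S, i' j ∈ S.map i).card
      ≤ k ^ k * n ^ (k - S.card) := by
  have hS : S.card ≤ k := by simpa using Finset.card_le_univ S
  calc _ ≤ (Fintype.piFinset fun j => if j ∈ S then S.map i else Finset.univ).card := by
        refine Finset.card_le_card_of_injOn (fun i' j => i' j) (fun i' hi' => ?_)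
          (fun i' _ i'' _ h => DFunLike.coe_injective h)
        rw [Finset.mem_coe, Fintype.mem_piFinset]
        intro j
        split_ifs with hj
        · exact (Finset.mem_filter.mp hi').2 j hj
        · exact Finset.mem_univ _
    _ = S.card ^ S.card * n ^ (k - S.card) := by
        have e : ∀ j, (if j ∈ S then S.map i else Finset.univ).card
            = if j ∈ S then S.card else n := by
          intro j
          split_ifs <;> simp
        rw [Fintype.card_piFinset]
        simp only [e]
        rw [Finset.prod_ite, Finset.prod_const, Finset.prod_const, Finset.filter_not]
        simp [Finset.card_sdiff]
    _ ≤ _ := by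
        refine Nat.mul_le_mul_right _ ?_
        rcases Nat.eq_zero_or_pos k with h0 | h0
        · have : S.card = 0 := by omega
          rw [this, h0]
        · exact (Nat.pow_le_pow_left hS _).trans (Nat.pow_le_pow_right h0 hS)

/-- Each factor of the falling factorial is at least `n + 1 - k`, and `n ≤ k (n + 1 - k)`. -/
theorem pow_le_pow_mul_descFactorial (hk : 1 ≤ k) (hkn : k ≤ n) :
    n ^ k ≤ k ^ k * n.descFactorial k := by
  have h : n ≤ k * (n + 1 - k) := by
    obtain ⟨r, rfl⟩ := Nat.exists_eq_add_of_le hkn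
    rw [show k + r + 1 - k = r + 1 by omega]
    nlinarith
  calc n ^ k ≤ (k * (n + 1 - k)) ^ k := Nat.pow_le_pow_left h k
    _ = k ^ k * (n + 1 - k) ^ k := mul_pow _ _ _
    _ ≤ _ := Nat.mul_le_mul_left _ (Nat.pow_sub_le_descFactorial n k)

theorem continuous_trace_evalWord_re (σ : Matrix (Fin d) (Fin d) ℂ) (w : List (Option (Fin n))) :
    Continuous fun u : Fin n → Fin d → ℂ => ((evalWord σ u w).trace).re :=
  Complex.continuous_re.comp (continuous_evalWord σ w).matrix_trace

theorem continuous_momentComponent (σ : Matrix (Fin d) (Fin d) ℂ) (S : Finset (Fin k)) :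
    Continuous (momentComponent (n := n) σ S) := by
  unfold momentComponent
  exact continuous_const.mul
    (continuous_finsetSum _ fun i _ => continuous_trace_evalWord_re σ (tupleWord S i))

/-- The expression is monotone in `c`, in a direction decided by whether `r ≤ q`, so it is bounded
by its value at one of the ends `c = 1` and `c = k`. -/
theorem pow_mul_pow_le_add {r q : ℝ} (hr : 0 ≤ r) (hq : 0 ≤ q) {c : ℕ} (hc : 1 ≤ c) (hck : c ≤ k) :
    r ^ c * q ^ (k - c) ≤ r * q ^ (k - 1) + r ^ k := by
  rcases le_total r q with h | h
  · calc r ^ c * q ^ (k - c) = r * (r ^ (c - 1) * q ^ (k - c)) := by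
          rw [← mul_assoc, ← pow_succ']
          congr 2
          omega
      _ ≤ r * (q ^ (c - 1) * q ^ (k - c)) := by gcongr
      _ = r * q ^ (k - 1) := by
          rw [← pow_add]
          congr 2
          omega
      _ ≤ _ := le_add_of_nonneg_right (pow_nonneg hr k)
  · calc r ^ c * q ^ (k - c) ≤ r ^ c * r ^ (k - c) := by gcongr
      _ = r ^ k := by rw [← pow_add]; congr 1; omega
      _ ≤ _ := le_add_of_nonneg_left (by positivity)

variable [NeZero d] {σ : Matrix (Fin d) (Fin d) ℂ}

theorem integral_trace_tupleWord_sq_le (hσ : IsDensityMatrix σ) {q : ℝ} (hq : 0 ≤ q)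
    (hN : ∀ a ≤ k - 1, frobSq (σ ^ a) ≤ d * q ^ a) {S : Finset (Fin k)} (hS : S.Nonempty)
    (i : Fin k ↪ Fin n) :
    ∫ u, ((evalWord σ u (tupleWord S i)).trace).re ^ 2 ∂(uniformPOVM d).outcomeCopies σ n
      ≤ (3 * d) ^ S.card * q ^ (k - S.card) := by
  obtain ⟨j, hj⟩ := hS
  have hlen : 0 + (tupleWord S i).length ≤ k - 1 + 1 := by
    simp only [tupleWord, List.length_ofFn]
    omega
  have h := integral_normSq_trace_evalWord_le hσ hq hN (distinctWord_tupleWord S i)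
    ⟨i j, mem_tupleWord.mpr (Finset.mem_map_of_mem i hj)⟩ hlen
  simp only [pow_zero, one_mul, prod_letterWeight_tupleWord] at h
  refine le_trans (integral_mono
    (((continuous_trace_evalWord_re σ _).pow 2).integrable_outcomeCopies hσ) (Continuous.integrable_outcomeCopies hσ
      (Complex.continuous_normSq.comp (continuous_evalWord σ _).matrix_trace)) fun u => ?_) h
  simp only [Function.comp_apply, Complex.normSq_apply]
  nlinarith [mul_self_nonneg ((evalWord σ u (tupleWord S i)).trace).im]

/-- Expand the square over pairs of tuples. Few pairs are correlated, and each of those is bounded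
by the second moment of a single word. One factor `k^k` comes from counting the pairs, the other
from comparing `n^k` with the falling factorial. -/
theorem integral_momentComponent_sq_le (hσ : IsDensityMatrix σ) (hk : 1 ≤ k) (hkn : k ≤ n) {q : ℝ}
    (hq : 0 ≤ q) (hN : ∀ a ≤ k - 1, frobSq (σ ^ a) ≤ d * q ^ a) {S : Finset (Fin k)}
    (hS : S.Nonempty) :
    ∫ u, momentComponent σ S u ^ 2 ∂(uniformPOVM d).outcomeCopies σ n
      ≤ k ^ (2 * k) * ((3 * d / n) ^ S.card * q ^ (k - S.card)) := by
  have hn : (0 : ℝ) < n := by exact_mod_cast hk.trans hkn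
  have hSk : S.card ≤ k := by simpa using Finset.card_le_univ S
  set B : ℝ := (3 * d) ^ S.card * q ^ (k - S.card) with hB
  have hB0 : 0 ≤ B := by positivity
  set t : (Fin k ↪ Fin n) → (Fin n → Fin d → ℂ) → ℝ :=
    fun i u => ((evalWord σ u (tupleWord S i)).trace).re with ht
  have hc : ∀ i, Continuous (t i) := fun i => continuous_trace_evalWord_re σ _
  have hint : ∀ i i', Integrable (fun u => t i u * t i' u)
      ((uniformPOVM d).outcomeCopies σ n) := fun i i' =>
    ((hc i).mul (hc i')).integrable_outcomeCopies hσ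
  have hint2 : ∀ i, Integrable (fun u => t i u ^ 2)
      ((uniformPOVM d).outcomeCopies σ n) := fun i =>
    ((hc i).pow 2).integrable_outcomeCopies hσ
  have hpair : ∀ i i', ∫ u, t i u * t i' u ∂(uniformPOVM d).outcomeCopies σ n
      ≤ if ∀ j ∈ S, i' j ∈ S.map i then B else 0 := by
    intro i i'
    split_ifs with h
    · calc _ ≤ ∫ u, (1 / 2) * t i u ^ 2 + (1 / 2) * t i' u ^ 2
            ∂(uniformPOVM d).outcomeCopies σ n := by
            refine integral_mono (hint i i')
              (((hint2 i).const_mul _).fun_add ((hint2 i').const_mul _)) fun u => ?_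
            nlinarith [sq_nonneg (t i u - t i' u)]
        _ ≤ B := by
            rw [integral_add ((hint2 i).const_mul _) ((hint2 i').const_mul _),
              integral_const_mul, integral_const_mul]
            linarith [integral_trace_tupleWord_sq_le hσ hq hN hS i,
              integral_trace_tupleWord_sq_le hσ hq hN hS i']
    -- Here the second word contains an estimator that is absent from the first.
    · push Not at h
      obtain ⟨j, hj, hj'⟩ := h
      exact (integral_mul_trace_evalWord_eq_zero hσ (distinctWord_tupleWord S i')
        (mem_tupleWord.mpr (Finset.mem_map_of_mem i' hj))
        (fun hm => hj' (mem_tupleWord.mp hm))).le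
  have hsum : ∫ u, (∑ i, t i u) ^ 2 ∂(uniformPOVM d).outcomeCopies σ n
      ≤ n.descFactorial k * (k ^ k * n ^ (k - S.card) * B) := by
    simp_rw [pow_two, Finset.sum_mul_sum]
    rw [integral_finsetSum _ fun i _ => integrable_finsetSum _ fun i' _ => hint i i']
    have hrow : ∀ i : Fin k ↪ Fin n, ∫ u, ∑ i', t i u * t i' u
        ∂(uniformPOVM d).outcomeCopies σ n ≤ k ^ k * n ^ (k - S.card) * B := by
      intro i
      rw [integral_finsetSum _ fun i' _ => hint i i']
      refine (Finset.sum_le_sum fun i' _ => hpair i i').trans ?_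
      rw [← Finset.sum_filter, Finset.sum_const, nsmul_eq_mul]
      refine mul_le_mul_of_nonneg_right ?_ hB0
      exact_mod_cast card_embedding_map_subset_le S i
    refine (Finset.sum_le_sum fun i _ => hrow i).trans_eq ?_
    rw [Finset.sum_const, Finset.card_univ, Fintype.card_embedding_eq, Fintype.card_fin,
      Fintype.card_fin, nsmul_eq_mul]
  have hD : (n : ℝ) ^ k ≤ k ^ k * n.descFactorial k := by
    exact_mod_cast pow_le_pow_mul_descFactorial hk hkn
  have hD0 : (0 : ℝ) < n.descFactorial k := by
    by_contra h
    have : (0 : ℝ) < n ^ k := by positivity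
    have h2 : (0 : ℝ) ≤ (k : ℝ) ^ k := by positivity
    nlinarith
  calc ∫ u, momentComponent σ S u ^ 2 ∂(uniformPOVM d).outcomeCopies σ n
      = ((n.descFactorial k : ℝ)⁻¹) ^ 2 *
          ∫ u, (∑ i, t i u) ^ 2 ∂(uniformPOVM d).outcomeCopies σ n := by
        simp_rw [momentComponent, mul_pow]
        rw [integral_const_mul]
    _ ≤ ((n.descFactorial k : ℝ)⁻¹) ^ 2 *
          (n.descFactorial k * (k ^ k * n ^ (k - S.card) * B)) := by gcongr
    _ = k ^ k * n ^ (k - S.card) * B / n.descFactorial k := by field_simp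
    _ ≤ k ^ (2 * k) * (B / n ^ S.card) := by
        rw [div_le_iff₀ hD0]
        calc (k : ℝ) ^ k * n ^ (k - S.card) * B = k ^ k * n ^ k * (B / n ^ S.card) := by
              rw [pow_sub₀ _ hn.ne' hSk]
              field_simp
          _ ≤ k ^ k * (k ^ k * n.descFactorial k) * (B / n ^ S.card) := by gcongr
          _ = _ := by rw [two_mul, pow_add]; ring
    _ = _ := by
        rw [hB, div_pow]
        ring

/-- The mean squared error of the moment estimator. -/
theorem integral_momentEstimator_sub_sq_le (hσ : IsDensityMatrix σ) (hk : 2 ≤ k) (hkn : k ≤ n) :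
    ∫ u, (momentEstimator k u - stateMoment σ k) ^ 2 ∂(uniformPOVM d).outcomeCopies σ n
      ≤ (4 ^ k * k ^ (2 * k)) * (3 * frobSq (σ ^ (k - 1)) / n + (3 * d / n) ^ k) := by
  have hd : (0 : ℝ) < d := by exact_mod_cast Nat.pos_of_ne_zero (NeZero.ne d)
  have hN1 : ((k - 1 : ℕ) : ℝ) ≠ 0 := by
    have : k - 1 ≠ 0 := by omega
    exact_mod_cast this
  set F := frobSq (σ ^ (k - 1)) with hF
  have hF0 : 0 ≤ F := frobSq_nonneg _
  -- The exponent is `k - 1` because a word with at least one estimator contains at most `k - 1`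
  -- states. With this `q`, the term `|S| = 1` equals exactly `3F/n`.
  set q : ℝ := (F / d) ^ (1 / ((k - 1 : ℕ) : ℝ)) with hq
  have hq0 : 0 ≤ q := by positivity
  have hqk : q ^ (k - 1) = F / d := by
    rw [hq, ← Real.rpow_natCast, ← Real.rpow_mul (by positivity), one_div_mul_cancel hN1,
      Real.rpow_one]
  have hN : ∀ a ≤ k - 1, frobSq (σ ^ a) ≤ d * q ^ a := fun a ha => hσ.frobSq_pow_le ha
  set T := Finset.univ.erase (∅ : Finset (Fin k)) with hT
  have hTcard : (T.card : ℝ) ≤ 2 ^ k := by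
    have : T.card ≤ 2 ^ k := by
      refine (Finset.card_le_univ T).trans_eq ?_
      simp
    exact_mod_cast this
  have hi : ∀ S : Finset (Fin k), Integrable (fun u => momentComponent σ S u ^ 2)
      ((uniformPOVM d).outcomeCopies σ n) := fun S =>
    ((continuous_momentComponent σ S).pow 2).integrable_outcomeCopies hσ
  have hcsum : Continuous fun u : Fin n → Fin d → ℂ => (∑ S ∈ T, momentComponent σ S u) ^ 2 :=
    (continuous_finsetSum _ fun S _ => continuous_momentComponent σ S).pow 2
  have hcomp : ∀ S ∈ T, ∫ u, momentComponent σ S u ^ 2 ∂(uniformPOVM d).outcomeCopies σ n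
      ≤ k ^ (2 * k) * (3 * F / n + (3 * d / n) ^ k) := by
    intro S hS
    have hSne : S.Nonempty := Finset.nonempty_iff_ne_empty.mpr (Finset.ne_of_mem_erase hS)
    refine (integral_momentComponent_sq_le hσ (by omega) hkn hq0 hN hSne).trans ?_
    gcongr
    refine (pow_mul_pow_le_add (by positivity) hq0 hSne.card_pos
      (by simpa using Finset.card_le_univ S)).trans_eq ?_
    rw [hqk]
    field_simp
  simp_rw [momentEstimator_sub_stateMoment σ hkn]
  -- Cauchy–Schwarz over at most `2^k` components; this count enters twice and yields `4^k`.
  calc _ ≤ ∫ u, (T.card : ℝ) * ∑ S ∈ T, momentComponent σ S u ^ 2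
        ∂(uniformPOVM d).outcomeCopies σ n :=
        integral_mono (hcsum.integrable_outcomeCopies hσ)
          ((integrable_finsetSum _ fun S _ => hi S).const_mul _)
          fun u => sq_sum_le_card_mul_sum_sq
    _ = T.card * ∑ S ∈ T, ∫ u, momentComponent σ S u ^ 2
        ∂(uniformPOVM d).outcomeCopies σ n := by
        rw [integral_const_mul, integral_finsetSum _ fun S _ => hi S]
    _ ≤ T.card * (T.card * (k ^ (2 * k) * (3 * F / n + (3 * d / n) ^ k))) := by
        gcongr
        refine (Finset.sum_le_sum hcomp).trans_eq ?_
        rw [Finset.sum_const, nsmul_eq_mul]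
    _ ≤ 2 ^ k * (2 ^ k * (k ^ (2 * k) * (3 * F / n + (3 * d / n) ^ k))) := by gcongr
    _ = _ := by
        rw [show (4 : ℝ) = 2 * 2 by norm_num, mul_pow]
        ring

end Variance

/-! ### Concentration and the entropy estimate -/

section Concentration

variable {d n k : ℕ}

theorem continuous_momentEstimator (hkn : k ≤ n) :
    Continuous fun u : Fin n → Fin d → ℂ => momentEstimator k u := by
  -- The decomposition is valid for every matrix in place of the state; the zero matrix reduces
  -- continuity to that of the components.
  have h : (fun u : Fin n → Fin d → ℂ => momentEstimator k u) = fun u =>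
      (∑ S ∈ Finset.univ.erase (∅ : Finset (Fin k)), momentComponent 0 S u)
        + stateMoment (0 : Matrix (Fin d) (Fin d) ℂ) k := by
    ext u
    rw [← momentEstimator_sub_stateMoment 0 hkn, sub_add_cancel]
  rw [h]
  exact (continuous_finsetSum _ fun S _ => continuous_momentComponent 0 S).add continuous_const

/-- Use `1 - 1/t ≤ log t ≤ t - 1` at `t = z/m`. The lower bound needs `(1 + δ)(1 - δ/2) ≥ 1`, which
is why the deviation is taken to be half of `δ m`. -/
theorem abs_log_sub_log_le {z m δ : ℝ} (hm : 0 < m) (hδ : 0 < δ) (hδ' : δ < 1 / 2)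
    (h : |z - m| < δ * m / 2) : |Real.log z - Real.log m| ≤ δ := by
  obtain ⟨h1, h2⟩ := abs_lt.mp h
  have hz : 0 < z := by nlinarith
  have e : Real.log z - Real.log m = Real.log (z / m) := (Real.log_div hz.ne' hm.ne').symm
  rw [e, abs_le]
  have hl := Real.one_sub_inv_le_log_of_pos (div_pos hz hm)
  have hu := Real.log_le_sub_one_of_pos (div_pos hz hm)
  constructor
  · refine le_trans ?_ hl
    rw [inv_div, neg_le_sub_iff_le_add, div_le_iff₀ hz]
    nlinarith
  · refine hu.trans ?_
    rw [sub_le_iff_le_add, div_le_iff₀ hm]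
    nlinarith

theorem abs_entropy_sub_le {z δ : ℝ} {σ : Matrix (Fin d) (Fin d) ℂ} (hk : 2 ≤ k)
    (hm : 0 < stateMoment σ k) (hδ : 0 < δ) (hδ' : δ < 1 / 2)
    (h : |z - stateMoment σ k| < δ * stateMoment σ k / 2) :
    |1 / (1 - (k : ℝ)) * Real.log z - renyiEntropy σ k| ≤ δ := by
  have hk' : (2 : ℝ) ≤ k := by exact_mod_cast hk
  rw [renyiEntropy, ← mul_sub, abs_mul]
  have h1 : |1 / (1 - (k : ℝ))| ≤ 1 := by
    rw [abs_div, abs_one, abs_sub_comm, abs_of_nonneg (by linarith), div_le_one (by linarith)]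
    linarith
  calc _ ≤ 1 * δ :=
        mul_le_mul h1 (abs_log_sub_log_le hm hδ hδ' h) (abs_nonneg _) zero_le_one
    _ = δ := one_mul δ

theorem div_le_of_mul_copyBound_le {C δ : ℝ} [NeZero d] (hC : 0 < C) (hδ : 0 < δ)
    (hn : C * copyBound k d δ ≤ n) : (d : ℝ) ^ (2 - 2 / (k : ℝ)) / n ≤ δ ^ 2 / C := by
  have hd : (0 : ℝ) < d := by exact_mod_cast Nat.pos_of_ne_zero (NeZero.ne d)
  have h1 : C * ((d : ℝ) ^ (2 - 2 / (k : ℝ)) / δ ^ 2) ≤ n :=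
    (mul_le_mul_of_nonneg_left (le_max_left _ _) hC.le).trans hn
  have hx : 0 < (d : ℝ) ^ (2 - 2 / (k : ℝ)) := Real.rpow_pos_of_pos hd _
  have hn0 : (0 : ℝ) < n := lt_of_lt_of_le (by positivity) h1
  rw [div_le_div_iff₀ hn0 hC]
  rw [← mul_div_assoc, div_le_iff₀ (by positivity)] at h1
  linarith

/-- The `k`-th power of the second term of the copy bound is `d^(3k-2)/δ²`, and `3k - 2 = k + 2(k -
1)`. The constant survives because `C ≤ C^k`. -/
theorem div_pow_le_of_mul_copyBound_le {C δ : ℝ} [NeZero d] (hk : 1 ≤ k) (hC : 1 ≤ C) (hδ : 0 < δ)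
    (hn : C * copyBound k d δ ≤ n) :
    ((d : ℝ) / n) ^ k * ((d : ℝ) ^ (k - 1)) ^ 2 ≤ δ ^ 2 / C := by
  have hd : (0 : ℝ) < d := by exact_mod_cast Nat.pos_of_ne_zero (NeZero.ne d)
  have hC0 : 0 < C := by linarith
  have hk0 : (k : ℝ) ≠ 0 := by positivity
  have h1 : C * ((d : ℝ) ^ (3 - 2 / (k : ℝ)) / δ ^ (2 / (k : ℝ))) ≤ n :=
    (mul_le_mul_of_nonneg_left (le_max_right _ _) hC0.le).trans hn
  have hx : 0 < (d : ℝ) ^ (3 - 2 / (k : ℝ)) := Real.rpow_pos_of_pos hd _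
  have hy : 0 < δ ^ (2 / (k : ℝ)) := Real.rpow_pos_of_pos hδ _
  have hn0 : (0 : ℝ) < n := lt_of_lt_of_le (by positivity) h1
  have h2 : (C * ((d : ℝ) ^ (3 - 2 / (k : ℝ)) / δ ^ (2 / (k : ℝ)))) ^ k ≤ (n : ℝ) ^ k :=
    pow_le_pow_left₀ (by positivity) h1 k
  have ex : ((d : ℝ) ^ (3 - 2 / (k : ℝ))) ^ k = d ^ k * ((d : ℝ) ^ (k - 1)) ^ 2 := by
    rw [← Real.rpow_natCast, ← Real.rpow_mul hd.le, ← pow_mul, ← pow_add, ← Real.rpow_natCast]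
    congr 1
    rw [Nat.cast_add, Nat.cast_mul, Nat.cast_sub hk]
    field_simp
    push_cast
    ring
  have ey : (δ ^ (2 / (k : ℝ))) ^ k = δ ^ 2 := by
    rw [← Real.rpow_natCast, ← Real.rpow_mul hδ.le, div_mul_cancel₀ _ hk0]
    norm_cast
  rw [mul_pow, div_pow, ex, ey] at h2
  have h3 : C ≤ C ^ k := le_self_pow₀ hC (by omega)
  rw [div_pow, div_mul_eq_mul_div, div_le_div_iff₀ (by positivity) hC0]
  have h4 : C * (d ^ k * ((d : ℝ) ^ (k - 1)) ^ 2 / δ ^ 2) ≤ n ^ k :=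
    (mul_le_mul_of_nonneg_right h3 (by positivity)).trans h2
  rw [← mul_div_assoc, div_le_iff₀ (by positivity)] at h4
  linarith

variable [NeZero d] {σ : Matrix (Fin d) (Fin d) ℂ}

/-- Chebyshev's inequality. In the constant, `12^k` is `4^k` from the mean squared error times `3^k`
from `(3d/n)^k`. Each of the two error terms is at most `δ²M²/800`, so their sum is one hundredth of
the squared threshold `(δM/2)²`. -/
theorem measureReal_abs_momentEstimator_sub_lt (hσ : IsDensityMatrix σ) (hk : 2 ≤ k) (hkn : k ≤ n)
    {δ : ℝ} (hδ : 0 < δ)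
    (hn : (800 * 12 ^ k * (k : ℝ) ^ (2 * k)) * copyBound k d δ ≤ n) :
    (99 / 100 : ℝ) ≤ ((uniformPOVM d).outcomeCopies σ n).real
      {u | |momentEstimator k u - stateMoment σ k| < δ * stateMoment σ k / 2} := by
  have := (uniformPOVM d).isProbabilityMeasure_outcome hσ
  have hν : IsProbabilityMeasure ((uniformPOVM d).outcomeCopies σ n) := by
    unfold POVM.outcomeCopies
    infer_instance
  have hk1 : (1 : ℝ) ≤ k := by exact_mod_cast (by omega : 1 ≤ k)
  set M := stateMoment σ k with hM
  have hM0 : 0 < M := hσ.stateMoment_pos (by omega)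
  set C : ℝ := 800 * 12 ^ k * (k : ℝ) ^ (2 * k) with hC
  have hC1 : 1 ≤ C := by
    have h1 : (1 : ℝ) ≤ 12 ^ k := one_le_pow₀ (by norm_num)
    have h2 : (1 : ℝ) ≤ (k : ℝ) ^ (2 * k) := one_le_pow₀ hk1
    rw [hC]
    nlinarith
  have hC0 : 0 < C := by linarith
  have hn0 : (0 : ℝ) < n := by exact_mod_cast (by omega : 0 < n)
  have hA : 3 * frobSq (σ ^ (k - 1)) / n ≤ 3 * (M ^ 2 * (δ ^ 2 / C)) := by
    calc 3 * frobSq (σ ^ (k - 1)) / n ≤ 3 * (M ^ 2 * (d : ℝ) ^ (2 - 2 / (k : ℝ))) / n := by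
          gcongr
          exact hσ.frobSq_pow_pred_le hk
      _ = 3 * (M ^ 2 * ((d : ℝ) ^ (2 - 2 / (k : ℝ)) / n)) := by ring
      _ ≤ _ := by
          gcongr 3 * (M ^ 2 * ?_)
          exact div_le_of_mul_copyBound_le hC0 hδ hn
  have hB : (3 * d / n : ℝ) ^ k ≤ 3 ^ k * (M ^ 2 * (δ ^ 2 / C)) := by
    have h1 := hσ.one_le_mul_stateMoment (k := k) (by omega)
    -- The term `(3d/n)^k` does not involve the state; this inequality makes it relative to `M²`.
    have h2 : 1 ≤ ((d : ℝ) ^ (k - 1)) ^ 2 * M ^ 2 := by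
      rw [← mul_pow]
      exact one_le_pow₀ h1
    calc (3 * d / n : ℝ) ^ k = 3 ^ k * (d / n : ℝ) ^ k := by rw [mul_div_assoc, mul_pow]
      _ ≤ 3 ^ k * ((d / n : ℝ) ^ k * (((d : ℝ) ^ (k - 1)) ^ 2 * M ^ 2)) := by
          gcongr
          exact le_mul_of_one_le_right (by positivity) h2
      _ = 3 ^ k * (M ^ 2 * ((d / n : ℝ) ^ k * ((d : ℝ) ^ (k - 1)) ^ 2)) := by ring
      _ ≤ _ := by
          gcongr 3 ^ k * (M ^ 2 * ?_)
          exact div_pow_le_of_mul_copyBound_le (by omega) hC1 hδ hn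
  have h3 : (3 : ℝ) ≤ 3 ^ k := le_self_pow₀ (by norm_num) (by omega)
  have hE : ∫ u, (momentEstimator k u - M) ^ 2 ∂(uniformPOVM d).outcomeCopies σ n
      ≤ δ ^ 2 * M ^ 2 / 400 := by
    refine (integral_momentEstimator_sub_sq_le hσ hk hkn).trans ?_
    have h4 : 0 ≤ M ^ 2 * (δ ^ 2 / C) := by positivity
    calc _ ≤ (4 ^ k * (k : ℝ) ^ (2 * k)) * (3 ^ k * (M ^ 2 * (δ ^ 2 / C))
          + 3 ^ k * (M ^ 2 * (δ ^ 2 / C))) := by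
          gcongr
          exact hA.trans (mul_le_mul_of_nonneg_right h3 h4)
      _ = δ ^ 2 * M ^ 2 / 400 := by
          rw [hC, show (12 : ℝ) = 4 * 3 by norm_num, mul_pow]
          field_simp
          ring
  have hcont : Continuous fun u : Fin n → Fin d → ℂ => (momentEstimator k u - M) ^ 2 :=
    ((continuous_momentEstimator hkn).sub continuous_const).pow 2
  set ε : ℝ := (δ * M / 2) ^ 2 with hε
  have hε0 : 0 < ε := by positivity
  have hmarkov := mul_meas_ge_le_integral_of_nonneg (μ := (uniformPOVM d).outcomeCopies σ n)
    (Filter.Eventually.of_forall fun u => sq_nonneg (momentEstimator k u - M))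
    (hcont.integrable_outcomeCopies hσ) ε
  have hbad : ((uniformPOVM d).outcomeCopies σ n).real
      {u | ε ≤ (momentEstimator k u - M) ^ 2} ≤ 1 / 100 := by
    have h5 : ε * ((uniformPOVM d).outcomeCopies σ n).real
        {u | ε ≤ (momentEstimator k u - M) ^ 2} ≤ ε * (1 / 100) :=
      (hmarkov.trans hE).trans_eq (by rw [hε]; ring)
    exact le_of_mul_le_mul_left h5 hε0
  have hmeas : MeasurableSet {u : Fin n → Fin d → ℂ | ε ≤ (momentEstimator k u - M) ^ 2} :=
    measurableSet_le measurable_const hcont.measurable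
  have hset : {u : Fin n → Fin d → ℂ | |momentEstimator k u - M| < δ * M / 2}
      = {u | ε ≤ (momentEstimator k u - M) ^ 2}ᶜ := by
    ext u
    simp only [Set.mem_ofPred_eq, Set.mem_compl_iff, not_le, hε]
    rw [sq_lt_sq, abs_of_nonneg (by positivity : 0 ≤ δ * M / 2)]
  rw [hset, probReal_compl_eq_one_sub hmeas]
  linarith

end Concentration

theorem theorem1p2 (k : ℕ) (hk : 2 ≤ k) :
    ∃ C : ℝ, 0 < C ∧
      ∀ (d : ℕ) [NeZero d] (σ : Matrix (Fin d) (Fin d) ℂ), IsDensityMatrix σ →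
        ∀ δ : ℝ, 0 < δ → ∀ n : ℕ, k ≤ n → C * copyBound k d δ ≤ (n : ℝ) →
          (99 / 100 : ℝ) ≤ ((uniformPOVM d).outcomeCopies σ n).real
            {u | (1 - δ) * stateMoment σ k ≤ momentEstimator k u ∧
              momentEstimator k u ≤ (1 + δ) * stateMoment σ k} ∧
          (δ < 1 / 2 →
            (99 / 100 : ℝ) ≤ ((uniformPOVM d).outcomeCopies σ n).real
              {u | ((1 - δ) * stateMoment σ k ≤ momentEstimator k u ∧
                momentEstimator k u ≤ (1 + δ) * stateMoment σ k) ∧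
                |1 / (1 - (k : ℝ)) * Real.log (momentEstimator k u) - renyiEntropy σ k|
                  ≤ δ}) := by
  refine ⟨800 * 12 ^ k * (k : ℝ) ^ (2 * k), by positivity, ?_⟩
  intro d _ σ hσ δ hδ n hkn hn
  have := (uniformPOVM d).isProbabilityMeasure_outcome hσ
  have hν : IsProbabilityMeasure ((uniformPOVM d).outcomeCopies σ n) := by
    unfold POVM.outcomeCopies
    infer_instance
  have hM : 0 < stateMoment σ k := hσ.stateMoment_pos (by omega)
  have hprob := measureReal_abs_momentEstimator_sub_lt hσ hk hkn hδ hn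
  have hbounds : ∀ z : ℝ, |z - stateMoment σ k| < δ * stateMoment σ k / 2 →
      (1 - δ) * stateMoment σ k ≤ z ∧ z ≤ (1 + δ) * stateMoment σ k := by
    intro z hz
    obtain ⟨h1, h2⟩ := abs_lt.mp hz
    have := mul_pos hδ hM
    constructor <;> linarith
  -- Both conclusions hold on the same event of deviation less than `δM/2`, so no union bound is
  -- needed.
  exact ⟨hprob.trans (measureReal_mono fun u hu => hbounds _ hu), fun hδ' =>
    hprob.trans (measureReal_mono fun u hu =>
      ⟨hbounds _ hu, abs_entropy_sub_le hk hM hδ hδ' hu⟩)⟩
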